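/- Let $n\ge 2$, and let $K\subset\mathbb R^{n+1}=\mathbb R^n\times\mathbb R$ be the $n$-dimensional catenoid, i.e. the minimal hypersurface parameterized by $$(s,\Theta)\in\mathbb R\times S^{n-1}\longmapsto(\phi(s)\,\Theta,\ \psi(s)),\qquad \phi(s)=\big(\cosh((n-1)s)\big)^{\frac1{n-1}},\qquad \psi(s)=\int_0^s\phi(t)^{2-n}\,dt .$$ A Jacobi field of $K$ is a $C^2$ function $f:K\to\mathbb R$ with $\Delta_K f+\|B_K\|^2 f=0$ on $K$, where $\Delta_K$ is the Laplace operator of the metric induced on $K$ by the Euclidean metric and $B_K$ is the second fundamental form of $K$ (for the unit normal $(-\phi^{1-n}\Theta,\ \partial_s\log\phi)$). Functions on $K$ are written as functions of $(s,\Theta)$. Fix $\delta<0$. Let $f$ be a Jacobi field of $K$ for which there is a constant $C$ such that $$|f(s,\Theta)|\le C\,(\cosh s)^{\delta}\qquad\text{for all }(s,\Theta)\in\mathbb R\times S^{n-1},$$ and which is invariant under $(s,\Theta)\mapsto(s,-\Theta)$, i.e. $f(s,-\Theta)=f(s,\Theta)$ for all $(s,\Theta)$. Then $f\equiv0$ on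 $K$. -/

import Mathlib

open scoped InnerProductSpace

noncomputable section

/-! ### Calculus on an oriented hypersurface of a Euclidean space

A hypersurface is a set `S` together with a unit normal field `N` (only the values of `N` on `S`
matter). Derivatives along `S` are derivatives within the set `S`. These are determined only in
directions tangent to `S`, and they are only ever used in tangent directions. -/

namespace Hypersurface

variable {E : Type*} [NormedAddCommGroup E] [InnerProductSpace ℝ E] [FiniteDimensional ℝ E]

/-- Orthogonal projection onto the tangent space at `p`, the orthogonal complement of `N p`. -/
def tangentProj (N : E → E) (p : E) : E →L[ℝ] E := (ℝ ∙ N p)ᗮ.starProjection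

/-- The gradient along `S` of a function `f` on `S`, as a tangent vector field. -/
def grad (S : Set E) (N : E → E) (f : E → ℝ) (p : E) : E :=
  tangentProj N p ((InnerProductSpace.toDual ℝ E).symm (fderivWithin ℝ f S p))

/-- The endomorphism `v ↦ (D_v V)ᵀ` of the tangent space at `p` for a vector field `V` along `S`,
extended by `0` to the normal line. -/
def tangentDeriv (S : Set E) (N : E → E) (V : E → E) (p : E) : E →L[ℝ] E :=
  tangentProj N p ∘L fderivWithin ℝ V S p ∘L tangentProj N p

/-- The divergence along `S`, `∑ ⟪D_{τᵢ} V, τᵢ⟫` for an orthonormal basis `τᵢ` of the tangent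
space. -/
def div (S : Set E) (N : E → E) (V : E → E) (p : E) : ℝ :=
  LinearMap.trace ℝ E (tangentDeriv S N V p).toLinearMap

/-- The Laplace (Laplace–Beltrami) operator of `S` with the induced metric, `div ∘ grad`. -/
def laplacian (S : Set E) (N : E → E) (f : E → ℝ) (p : E) : ℝ :=
  div S N (grad S N f) p

/-- The shape operator, whose quadratic form is the second fundamental form
`B(v, w) = -⟪D_v N, w⟫` (extended by `0` to the normal line). -/
def shapeOperator (S : Set E) (N : E → E) (p : E) : E →L[ℝ] E :=
  -tangentDeriv S N N p

/-- The squared norm `∑ B(τᵢ, τⱼ)²` of the second fundamental form. -/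
def normSqSecondFundamentalForm (S : Set E) (N : E → E) (p : E) : ℝ :=
  LinearMap.trace ℝ E
    (ContinuousLinearMap.adjoint (shapeOperator S N p) ∘L shapeOperator S N p).toLinearMap

/-- The Jacobi operator `Δ_S + ‖B_S‖²`; the term `Ric(N, N)` vanishes since the ambient space is
flat. -/
def jacobiOperator (S : Set E) (N : E → E) (f : E → ℝ) (p : E) : ℝ :=
  laplacian S N f p + normSqSecondFundamentalForm S N p * f p

/-- A Jacobi field of `S`: a twice continuously differentiable function on `S` that is annihilated
by the Jacobi operator. Only the values of `f` on `S` matter. -/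
def IsJacobiField (S : Set E) (N : E → E) (f : E → ℝ) : Prop :=
  ContDiffOn ℝ 2 f S ∧ ∀ p ∈ S, jacobiOperator S N f p = 0

end Hypersurface

/-! ### The generalized catenoid -/

namespace Catenoid

/-- `ℝⁿ⁺¹ = ℝⁿ × ℝ` with the Euclidean inner product. -/
abbrev Ambient (n : ℕ) : Type := WithLp 2 (EuclideanSpace ℝ (Fin n) × ℝ)

/-- The unit sphere `Sⁿ⁻¹` of `ℝⁿ`. -/
abbrev UnitSphere (n : ℕ) : Type := Metric.sphere (0 : EuclideanSpace ℝ (Fin n)) 1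

/-- `φ(s) = cosh((n-1)s) ^ (1/(n-1))`. -/
def phi (n : ℕ) (s : ℝ) : ℝ := Real.cosh (((n : ℝ) - 1) * s) ^ (1 / ((n : ℝ) - 1))

/-- `ψ(s) = ∫₀ˢ φ(t)²⁻ⁿ dt`. -/
def psi (n : ℕ) (s : ℝ) : ℝ := ∫ t in (0 : ℝ)..s, phi n t ^ (2 - (n : ℝ))

/-- The parameterization `(s, Θ) ↦ (φ(s) Θ, ψ(s))`. -/
def param (n : ℕ) (q : ℝ × UnitSphere n) : Ambient n :=
  WithLp.toLp 2 (phi n q.1 • (q.2 : EuclideanSpace ℝ (Fin n)), psi n q.1)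

/-- The generalized catenoid `K` in `ℝⁿ⁺¹`. -/
def surface (n : ℕ) : Set (Ambient n) := Set.range (param n)

/-- The unit normal `(-φ¹⁻ⁿ Θ, ∂ₛ log φ)` at the point with parameters `(s, Θ)`. -/
def paramNormal (n : ℕ) (q : ℝ × UnitSphere n) : Ambient n :=
  WithLp.toLp 2 (-(phi n q.1 ^ (1 - (n : ℝ))) • (q.2 : EuclideanSpace ℝ (Fin n)),
    deriv (fun t => Real.log (phi n t)) q.1)

/-- The unit normal field of `K` as a function on `ℝⁿ⁺¹`, with value `0` off `K`. -/
def normal (n : ℕ) : Ambient n → Ambient n := Function.extend (param n) (paramNormal n) 0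

theorem phi_pos (n : ℕ) (s : ℝ) : 0 < phi n s := Real.rpow_pos_of_pos (Real.cosh_pos _) _

theorem continuous_phi (n : ℕ) : Continuous (phi n) :=
  (Real.continuous_cosh.comp (continuous_const.mul continuous_id)).rpow_const
    fun _ => Or.inl (Real.cosh_pos _).ne'

theorem psi_strictMono (n : ℕ) : StrictMono (psi n) := by
  have hc : Continuous fun t => phi n t ^ (2 - (n : ℝ)) :=
    (continuous_phi n).rpow_const fun t => Or.inl (phi_pos n t).ne'
  intro a b hab
  have hi : ∀ x y : ℝ, IntervalIntegrable (fun t => phi n t ^ (2 - (n : ℝ)))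
      MeasureTheory.volume x y := fun x y => hc.intervalIntegrable x y
  have h := intervalIntegral.intervalIntegral_pos_of_pos (hi a b)
    (fun t => Real.rpow_pos_of_pos (phi_pos n t) _) hab
  have h2 := intervalIntegral.integral_interval_sub_left (hi 0 b) (hi 0 a)
  simp only [psi]
  linarith

theorem param_injective (n : ℕ) : Function.Injective (param n) := by
  rintro ⟨s, Θ⟩ ⟨s', Θ'⟩ h
  have h' := congrArg WithLp.ofLp h
  simp only [param, Prod.mk.injEq] at h'
  obtain ⟨h1, h2⟩ := h'
  have hs : s = s' := (psi_strictMono n).injective h2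
  subst hs
  have := smul_right_injective (EuclideanSpace ℝ (Fin n)) (phi_pos n s).ne' h1
  rw [Subtype.ext this]

theorem normal_param (n : ℕ) (q : ℝ × UnitSphere n) : normal n (param n q) = paramNormal n q :=
  (param_injective n).extend_apply _ _ _

end Catenoid

end

open scoped InnerProductSpace

noncomputable section

set_option linter.unusedSectionVars false

open Filter Topology

/-! Of the bound only the decay of `f` at both ends matters; the rate plays no role. In the
coordinates `(s, Θ)` the Jacobi equation, multiplied by `φ²`, becomes `u_ss + (n-2) tanh((n-1)s) u_s
+ Δ_S u + n(n-1) sech²((n-1)s) u = 0` (`solvesJacobiEquation_of_isJacobiField`). The sphere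
Laplacian is handled through second derivatives along great circles, which is all a maximum
principle needs.

The heart is that an even decaying solution is rotationally symmetric
(`IsVanishingSolution.le_of_even`). Given unit vectors `x ≠ ±y`, let `P` be the reflection
exchanging `x` and `y`, and `Q` the one exchanging `x` and `-y`; their mirrors are orthogonal.
Antisymmetrizing `u` under both gives a decaying solution `v` that vanishes on both mirrors, and
evenness gives `v(x) = 2(u(x) - u(y))`. On the quarter of the catenoid cut out by the mirrors there
is a strict supersolution with a positive lower bound (`exists_jets_barrier`, `barrier_ge`).
Comparing `v` with its multiples yields `v ≤ 0` there (`IsVanishingSolution.nonpos_of_quarter`),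
hence `u(x) ≤ u(y)`, and equality by exchanging `x` and `y`.

A rotationally symmetric solution satisfies a linear second-order ODE, solved by the Jacobi fields
of vertical translation (odd in `s`) and dilation (even in `s`). Both stay away from zero for `s ≥
2`, so a combination that decays at both ends is zero (`eq_zero_of_ode`). -/

/-- `g` is differentiable near `t`, with first derivative `g₁` and second derivative `g₂` at `t`. -/
def HasTwoJetAt (g : ℝ → ℝ) (g₁ g₂ t : ℝ) : Prop :=
  ∃ g' : ℝ → ℝ, g' t = g₁ ∧ (∀ᶠ r in 𝓝 t, HasDerivAt g (g' r) r) ∧ HasDerivAt g' g₂ t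

/-! ### One-variable second-order calculus -/

namespace HasTwoJetAt

variable {g h : ℝ → ℝ} {g₁ g₂ h₁ h₂ t : ℝ}

theorem add (hg : HasTwoJetAt g g₁ g₂ t) (hh : HasTwoJetAt h h₁ h₂ t) :
    HasTwoJetAt (fun r => g r + h r) (g₁ + h₁) (g₂ + h₂) t := by
  obtain ⟨g', rfl, hg1, hg2⟩ := hg
  obtain ⟨h', rfl, hh1, hh2⟩ := hh
  refine ⟨fun r => g' r + h' r, rfl, ?_, hg2.add hh2⟩
  filter_upwards [hg1, hh1] with r h1 h2 using h1.add h2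

theorem const_mul (c : ℝ) (hg : HasTwoJetAt g g₁ g₂ t) :
    HasTwoJetAt (fun r => c * g r) (c * g₁) (c * g₂) t := by
  obtain ⟨g', rfl, hg1, hg2⟩ := hg
  refine ⟨fun r => c * g' r, rfl, ?_, hg2.const_mul c⟩
  filter_upwards [hg1] with r h1 using h1.const_mul c

theorem sub (hg : HasTwoJetAt g g₁ g₂ t) (hh : HasTwoJetAt h h₁ h₂ t) :
    HasTwoJetAt (fun r => g r - h r) (g₁ - h₁) (g₂ - h₂) t := by
  convert hg.add (hh.const_mul (-1)) using 1
  · ext r; ring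
  · ring
  · ring

theorem of_hasDerivAt {g' : ℝ → ℝ} (hg : ∀ r, HasDerivAt g (g' r) r)
    (hg' : HasDerivAt g' g₂ t) : HasTwoJetAt g (g' t) g₂ t :=
  ⟨g', rfl, Eventually.of_forall hg, hg'⟩

theorem continuousAt (hg : HasTwoJetAt g g₁ g₂ t) : ContinuousAt g t := by
  obtain ⟨g', rfl, hg1, hg2⟩ := hg
  exact hg1.self_of_nhds.continuousAt

theorem first_eq_zero (hg : HasTwoJetAt g g₁ g₂ t) (hm : IsLocalMax g t) : g₁ = 0 := by
  obtain ⟨g', rfl, hg1, hg2⟩ := hg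
  exact hm.hasDerivAt_eq_zero hg1.self_of_nhds

/-- If the second derivative were positive, the point would also be a local minimum; then `g` is
locally constant and its second derivative is zero. -/
theorem second_nonpos (hg : HasTwoJetAt g g₁ g₂ t) (hm : IsLocalMax g t) : g₂ ≤ 0 := by
  have h0 := hg.first_eq_zero hm
  have hc := hg.continuousAt
  obtain ⟨g', rfl, hg1, hg2⟩ := hg
  by_contra! hpos
  have hd : deriv g =ᶠ[𝓝 t] g' := hg1.mono fun r hr => hr.deriv
  have hdd : deriv (deriv g) t = g₂ := by rw [hd.deriv_eq, hg2.deriv]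
  have hmin := isLocalMin_of_deriv_deriv_pos (by rw [hdd]; exact hpos)
    (by rw [hd.self_of_nhds, h0]) hc
  have hconst : g =ᶠ[𝓝 t] fun _ => g t := by
    filter_upwards [hm, hmin] with r h1 h2 using le_antisymm h1 h2
  have hd0 : deriv g =ᶠ[𝓝 t] fun _ => 0 := by
    filter_upwards [hconst.eventuallyEq_nhds] with r hr
    rw [hr.deriv_eq, deriv_const]
  rw [hd0.deriv_eq, deriv_const] at hdd
  exact hpos.ne hdd

theorem unique (hg : HasTwoJetAt g g₁ g₂ t) (hh : HasTwoJetAt g h₁ h₂ t) : g₁ = h₁ ∧ g₂ = h₂ := by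
  obtain ⟨g', rfl, hg1, hg2⟩ := hg
  obtain ⟨h', rfl, hh1, hh2⟩ := hh
  refine ⟨hg1.self_of_nhds.unique hh1.self_of_nhds, hg2.unique (hh2.congr_of_eventuallyEq ?_)⟩
  filter_upwards [hg1, hh1] with r h1 h2 using h1.unique h2

end HasTwoJetAt

/-! ### Differentiation along a hypersurface -/

namespace Hypersurface

variable {E : Type*} [NormedAddCommGroup E] [InnerProductSpace ℝ E] [FiniteDimensional ℝ E]
  {S : Set E} {N : E → E} {f : E → ℝ} {p : E}

theorem tangentProj_apply (hN : ‖N p‖ = 1) (v : E) :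
    tangentProj N p v = v - ⟪N p, v⟫_ℝ • N p := by
  rw [tangentProj, Submodule.starProjection_orthogonal_val,
    Submodule.starProjection_unit_singleton ℝ hN]

theorem tangentProj_of_inner_eq_zero {w : E} (hw : ⟪N p, w⟫_ℝ = 0) : tangentProj N p w = w :=
  Submodule.starProjection_eq_self_iff.2 (Submodule.mem_orthogonal_singleton_iff_inner_right.2 hw)

theorem inner_tangentProj (v w : E) : ⟪tangentProj N p v, w⟫_ℝ = ⟪v, tangentProj N p w⟫_ℝ :=
  Submodule.inner_starProjection_left_eq_right _ v w

theorem inner_grad {w : E} (hw : ⟪N p, w⟫_ℝ = 0) :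
    ⟪grad S N f p, w⟫_ℝ = fderivWithin ℝ f S p w := by
  rw [grad, inner_tangentProj, tangentProj_of_inner_eq_zero hw,
    InnerProductSpace.toDual_symm_apply]

/-- `fderivWithin` is determined only on the span of the tangent cone, so it may differ from a
regular choice `f'` of derivative in other directions. By `hT` the two agree on tangent vectors,
hence after projection. -/
theorem differentiableWithinAt_grad (hf : ContDiffOn ℝ 2 f S) (hp : p ∈ S)
    (hN : ∀ x ∈ S, ‖N x‖ = 1) (hNd : DifferentiableWithinAt ℝ N S p)
    (hT : ∀ x ∈ S, (ℝ ∙ N x)ᗮ ≤ Submodule.span ℝ (tangentConeAt ℝ S x)) :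
    DifferentiableWithinAt ℝ (grad S N f) S p := by
  have h2 : ContDiffWithinAt ℝ (1 + 1) f S p := by
    have := hf p hp
    norm_num
    exact this
  obtain ⟨u, hu, -, -, f', hf', hf'c⟩ :=
    (contDiffWithinAt_succ_iff_hasFDerivWithinAt' (by simp)).1 h2
  rw [Set.insert_eq_of_mem hp] at hu
  set D := (InnerProductSpace.toDual ℝ E).symm
  have hd : DifferentiableWithinAt ℝ (fun x => D (f' x)) S p :=
    D.toContinuousLinearEquiv.differentiableAt.comp_differentiableWithinAt p
      (hf'c.differentiableWithinAt (by simp))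
  have hd2 : DifferentiableWithinAt ℝ
      (fun x => D (f' x) - ⟪N x, D (f' x)⟫_ℝ • N x) S p :=
    hd.sub ((hNd.inner ℝ hd).smul hNd)
  refine hd2.congr_of_eventuallyEq_of_mem ?_ hp
  filter_upwards [hu, self_mem_nhdsWithin] with x hx hxS
  rw [← tangentProj_apply (hN x hxS), grad]
  refine ext_inner_right ℝ fun w => ?_
  rw [inner_tangentProj, inner_tangentProj, InnerProductSpace.toDual_symm_apply,
    InnerProductSpace.toDual_symm_apply]
  have hw : tangentProj N x w ∈ Submodule.span ℝ (tangentConeAt ℝ S x) :=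
    hT x hxS (Submodule.starProjection_apply_mem _ _)
  have heq : Set.EqOn (fderivWithin ℝ f S x) (f' x) (tangentConeAt ℝ S x) :=
    (hf' x hx).differentiableWithinAt.hasFDerivWithinAt.unique_on (hf' x hx)
  exact LinearMap.eqOn_span (f := (fderivWithin ℝ f S x).toLinearMap)
    (g := (f' x).toLinearMap) heq hw

/-- The chain rule applied twice. It links the divergence of the gradient to second derivatives
along curves, the acceleration entering as a correction. -/
theorem hasTwoJetAt_comp (hf : DifferentiableOn ℝ f S) {γ γ' : ℝ → E} {γ'' : E} {t : ℝ}
    (hγS : ∀ r, γ r ∈ S) (hγ : ∀ r, HasDerivAt γ (γ' r) r)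
    (hγN : ∀ r, ⟪N (γ r), γ' r⟫_ℝ = 0) (hγ' : HasDerivAt γ' γ'' t)
    (hV : DifferentiableWithinAt ℝ (grad S N f) S (γ t)) :
    HasTwoJetAt (fun r => f (γ r)) ⟪grad S N f (γ t), γ' t⟫_ℝ
      (⟪fderivWithin ℝ (grad S N f) S (γ t) (γ' t), γ' t⟫_ℝ + ⟪grad S N f (γ t), γ''⟫_ℝ) t := by
  refine HasTwoJetAt.of_hasDerivAt (g' := fun r => ⟪grad S N f (γ r), γ' r⟫_ℝ) (fun r => ?_) ?_
  · rw [inner_grad (hγN r)]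
    have := (hf (γ r) (hγS r)).hasFDerivWithinAt.comp_hasDerivWithinAt (s := Set.univ) r
      (hγ r).hasDerivWithinAt (fun x _ => hγS x)
    exact this.hasDerivAt univ_mem
  · have h1 : HasDerivAt (fun r => grad S N f (γ r))
        (fderivWithin ℝ (grad S N f) S (γ t) (γ' t)) t :=
      (hV.hasFDerivWithinAt.comp_hasDerivWithinAt (s := Set.univ) t
        (hγ t).hasDerivWithinAt (fun x _ => hγS x)).hasDerivAt univ_mem
    have := h1.inner ℝ hγ'
    rwa [add_comm] at this

theorem fderivWithin_apply_of_curve {V : E → E} (hV : DifferentiableWithinAt ℝ V S p) {γ : ℝ → E}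
    {γ' v : E} {t : ℝ} (hγt : γ t = p) (hγS : ∀ r, γ r ∈ S) (hγ : HasDerivAt γ γ' t)
    (hv : HasDerivAt (fun r => V (γ r)) v t) : fderivWithin ℝ V S p γ' = v := by
  subst hγt
  exact ((hV.hasFDerivWithinAt.comp_hasDerivWithinAt (s := Set.univ) t
    hγ.hasDerivWithinAt (fun x _ => hγS x)).hasDerivAt univ_mem).unique hv

/-- Velocities of explicit curves are what shows that the tangent cone spans the tangent space. -/
theorem mem_tangentConeAt_of_curve {γ : ℝ → E} {γ' : E} {t : ℝ} (hγt : γ t = p)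
    (hγS : ∀ r, γ r ∈ S) (hγ : HasDerivAt γ γ' t) : γ' ∈ tangentConeAt ℝ S p := by
  subst hγt
  have h : ContinuousLinearMap.toSpanSingleton ℝ γ' 1 ∈ tangentConeAt ℝ (γ '' Set.univ) (γ t) :=
    (hγ.hasFDerivAt.hasFDerivWithinAt (s := Set.univ)).mapsTo_tangent_cone (by simp)
  have h2 : γ' ∈ tangentConeAt ℝ (γ '' Set.univ) (γ t) := by simpa using h
  exact tangentConeAt_mono (by rintro _ ⟨r, -, rfl⟩; exact hγS r) h2

/-- In an orthonormal basis containing `N p`, the normal vector contributes nothing to the trace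
because the projection kills it. -/
theorem div_eq_sum {ι : Type*} [Fintype ι] (b : OrthonormalBasis (Option ι) ℝ E)
    (hb : b none = N p) (V : E → E) :
    div S N V p = ∑ i, ⟪b (some i), fderivWithin ℝ V S p (b (some i))⟫_ℝ := by
  have hb1 : ∀ i, ⟪N p, b (some i)⟫_ℝ = 0 := fun i => by
    rw [← hb]; exact b.orthonormal.2 (by simp)
  have hb0 : tangentProj N p (N p) = 0 := by
    rw [tangentProj_apply (by rw [← hb]; exact b.orthonormal.1 _), real_inner_self_eq_norm_sq,
      ← hb, b.orthonormal.1]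
    simp
  rw [div, LinearMap.trace_eq_sum_inner _ b, Fintype.sum_option]
  simp [tangentDeriv, hb, hb0, ← inner_tangentProj, tangentProj_of_inner_eq_zero (hb1 _)]

theorem normSqSecondFundamentalForm_eq_sum {ι : Type*} [Fintype ι]
    (b : OrthonormalBasis (Option ι) ℝ E) (hb : b none = N p) :
    normSqSecondFundamentalForm S N p =
      ∑ i, ‖tangentProj N p (fderivWithin ℝ N S p (b (some i)))‖ ^ 2 := by
  have hb1 : ∀ i, ⟪N p, b (some i)⟫_ℝ = 0 := fun i => by
    rw [← hb]; exact b.orthonormal.2 (by simp)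
  have hb0 : tangentProj N p (N p) = 0 := by
    rw [tangentProj_apply (by rw [← hb]; exact b.orthonormal.1 _), real_inner_self_eq_norm_sq,
      ← hb, b.orthonormal.1]
    simp
  rw [normSqSecondFundamentalForm, LinearMap.trace_eq_sum_inner _ b, Fintype.sum_option]
  simp [shapeOperator, tangentDeriv, hb, hb0, ContinuousLinearMap.adjoint_inner_right,
    tangentProj_of_inner_eq_zero (hb1 _)]

end Hypersurface

/-! ### Coordinates, normal and orthonormal frames of the catenoid -/

namespace Catenoid

/-- A shortcut: instance search does not find this in reasonable time. -/
instance continuousSMulAmbient (n : ℕ) : ContinuousSMul ℝ (Ambient n) :=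
  have h {E : Type} [NormedAddCommGroup E] [InnerProductSpace ℝ E] : ContinuousSMul ℝ E :=
    inferInstance
  h

/-- `sech((n-1)s)`, which equals `φ¹⁻ⁿ`. -/
def sech (n : ℕ) (s : ℝ) : ℝ := (Real.cosh (((n : ℝ) - 1) * s))⁻¹

/-- `tanh((n-1)s)`, the logarithmic derivative of `φ`. -/
def th (n : ℕ) (s : ℝ) : ℝ := Real.sinh (((n : ℝ) - 1) * s) * (Real.cosh (((n : ℝ) - 1) * s))⁻¹

variable {n : ℕ}

theorem sech_pos (s : ℝ) : 0 < sech n s := inv_pos.2 (Real.cosh_pos _)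

theorem sech_le_one (s : ℝ) : sech n s ≤ 1 := inv_le_one_of_one_le₀ (Real.one_le_cosh _)

theorem th_sq (s : ℝ) : th n s ^ 2 = 1 - sech n s ^ 2 := by
  have h := Real.cosh_sq (((n : ℝ) - 1) * s)
  have hc := (Real.cosh_pos (((n : ℝ) - 1) * s)).ne'
  rw [th, sech]
  field_simp
  linarith

theorem hasDerivAt_sech (s : ℝ) :
    HasDerivAt (sech n) (-((n : ℝ) - 1) * (sech n s * th n s)) s := by
  have h1 : HasDerivAt (fun s => ((n : ℝ) - 1) * s) ((n : ℝ) - 1) s := by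
    simpa using (hasDerivAt_id s).const_mul ((n : ℝ) - 1)
  refine HasDerivAt.congr_deriv (f := sech n) (h1.cosh.inv (Real.cosh_pos _).ne') ?_
  have hc := (Real.cosh_pos (((n : ℝ) - 1) * s)).ne'
  rw [th, sech]
  field_simp

theorem hasDerivAt_th (s : ℝ) : HasDerivAt (th n) (((n : ℝ) - 1) * sech n s ^ 2) s := by
  have h1 : HasDerivAt (fun s => ((n : ℝ) - 1) * s) ((n : ℝ) - 1) s := by
    simpa using (hasDerivAt_id s).const_mul ((n : ℝ) - 1)
  refine HasDerivAt.congr_deriv (f := th n) (h1.sinh.mul (h1.cosh.inv (Real.cosh_pos _).ne')) ?_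
  have hc := (Real.cosh_pos (((n : ℝ) - 1) * s)).ne'
  have h := Real.cosh_sq (((n : ℝ) - 1) * s)
  rw [sech]
  field_simp
  rw [h]; ring

theorem continuous_sech : Continuous (sech n) :=
  continuous_iff_continuousAt.2 fun s => (hasDerivAt_sech s).continuousAt

theorem hasDerivAt_phi (hn : 2 ≤ n) (s : ℝ) : HasDerivAt (phi n) (phi n s * th n s) s := by
  have hn' : (n : ℝ) - 1 ≠ 0 := by
    have : (2 : ℝ) ≤ n := by exact_mod_cast hn
    linarith
  have h1 : HasDerivAt (fun s => ((n : ℝ) - 1) * s) ((n : ℝ) - 1) s := by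
    simpa using (hasDerivAt_id s).const_mul ((n : ℝ) - 1)
  have hc := Real.cosh_pos (((n : ℝ) - 1) * s)
  refine HasDerivAt.congr_deriv (f := phi n)
    (h1.cosh.rpow_const (p := 1 / ((n : ℝ) - 1)) (Or.inl hc.ne')) ?_
  rw [Real.rpow_sub_one hc.ne', th, phi]
  field_simp

theorem phi_rpow_one_sub (hn : 2 ≤ n) (s : ℝ) : phi n s ^ (1 - (n : ℝ)) = sech n s := by
  have hn' : (n : ℝ) - 1 ≠ 0 := by
    have : (2 : ℝ) ≤ n := by exact_mod_cast hn
    linarith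
  have hc := Real.cosh_pos (((n : ℝ) - 1) * s)
  rw [phi, ← Real.rpow_mul hc.le, sech, ← Real.rpow_neg_one]
  congr 1
  field_simp
  ring

theorem phi_rpow_two_sub (hn : 2 ≤ n) (s : ℝ) :
    phi n s ^ (2 - (n : ℝ)) = phi n s * sech n s := by
  rw [show 2 - (n : ℝ) = 1 + (1 - n) by ring, Real.rpow_add (phi_pos n s), Real.rpow_one,
    phi_rpow_one_sub hn]

theorem hasStrictDerivAt_psi (hn : 2 ≤ n) (s : ℝ) :
    HasStrictDerivAt (psi n) (phi n s * sech n s) s := by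
  have hc : Continuous fun t => phi n t ^ (2 - (n : ℝ)) :=
    (continuous_phi n).rpow_const fun t => Or.inl (phi_pos n t).ne'
  rw [← phi_rpow_two_sub hn]
  exact intervalIntegral.integral_hasStrictDerivAt_right (hc.intervalIntegrable _ _)
    hc.stronglyMeasurable.stronglyMeasurableAtFilter hc.continuousAt

theorem hasDerivAt_psi (hn : 2 ≤ n) (s : ℝ) : HasDerivAt (psi n) (phi n s * sech n s) s :=
  (hasStrictDerivAt_psi hn s).hasDerivAt

/-- The height coordinate determines the parameter `s` of a point of the catenoid. -/
def height (n : ℕ) : ℝ → ℝ := Function.invFun (psi n)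

theorem height_psi (s : ℝ) : height n (psi n s) = s :=
  Function.leftInverse_invFun (psi_strictMono n).injective s

/-- The nonzero strict derivative makes `psi` map neighbourhoods onto neighbourhoods, so its inverse
is continuous at `psi n s`. The argument is local: `psi` need not be surjective. -/
theorem differentiableAt_height (hn : 2 ≤ n) (s : ℝ) :
    DifferentiableAt ℝ (height n) (psi n s) := by
  have hne : phi n s * sech n s ≠ 0 := (mul_pos (phi_pos n s) (sech_pos s)).ne'
  have hmap := (hasStrictDerivAt_psi hn s).map_nhds_eq hne
  have hcont : ContinuousAt (height n) (psi n s) := by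
    rw [ContinuousAt, height_psi, ← hmap, tendsto_map'_iff]
    exact tendsto_id.congr fun t => (height_psi t).symm
  refine (HasDerivAt.of_local_left_inverse hcont (f := psi n) (f' := phi n s * sech n s)
    ?_ hne ?_).differentiableAt
  · rw [height_psi]; exact hasDerivAt_psi hn s
  · rw [← hmap, eventually_map]
    exact Eventually.of_forall fun t => by rw [height_psi]

theorem paramNormal_eq (hn : 2 ≤ n) (s : ℝ) (Θ : UnitSphere n) : paramNormal n (s, Θ) =
    WithLp.toLp 2 (-sech n s • (Θ : EuclideanSpace ℝ (Fin n)), th n s) := by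
  have h : deriv (fun t => Real.log (phi n t)) s = th n s := by
    rw [((hasDerivAt_phi hn s).log (phi_pos n s).ne').deriv]
    field_simp [(phi_pos n s).ne']
  rw [paramNormal]
  simp only [phi_rpow_one_sub hn, h]

/-- On the surface the normal agrees with an ambient formula: `height` recovers `s`, and the
horizontal part divided by `φ` recovers `Θ`. That formula is differentiable at points of the
surface. -/
theorem differentiableWithinAt_normal (hn : 2 ≤ n) (q : ℝ × UnitSphere n) :
    DifferentiableWithinAt ℝ (normal n) (surface n) (param n q) := by
  have hfst : DifferentiableAt ℝ (fun p : Ambient n => p.fst) (param n q) :=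
    (WithLp.fstL 2 ℝ (EuclideanSpace ℝ (Fin n)) ℝ).differentiableAt
  have hsnd : DifferentiableAt ℝ (fun p : Ambient n => p.snd) (param n q) :=
    (WithLp.sndL 2 ℝ (EuclideanSpace ℝ (Fin n)) ℝ).differentiableAt
  have hh : DifferentiableAt ℝ (fun p : Ambient n => height n p.snd) (param n q) :=
    DifferentiableAt.comp (param n q) (differentiableAt_height hn q.1) hsnd
  have hs : DifferentiableAt ℝ (fun p : Ambient n => sech n (height n p.snd)) (param n q) :=
    DifferentiableAt.comp (g := sech n) (param n q) (hasDerivAt_sech _).differentiableAt hh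
  have ht : DifferentiableAt ℝ (fun p : Ambient n => th n (height n p.snd)) (param n q) :=
    DifferentiableAt.comp (g := th n) (param n q) (hasDerivAt_th _).differentiableAt hh
  have hp : DifferentiableAt ℝ (fun p : Ambient n => phi n (height n p.snd)) (param n q) :=
    DifferentiableAt.comp (g := phi n) (param n q) (hasDerivAt_phi hn _).differentiableAt hh
  have key : DifferentiableAt ℝ (fun p : Ambient n => (WithLp.toLp 2
      ((-sech n (height n p.snd) * (phi n (height n p.snd))⁻¹) • p.fst,
        th n (height n p.snd)) : Ambient n)) (param n q) :=
    (WithLp.prodContinuousLinearEquiv 2 ℝ (EuclideanSpace ℝ (Fin n)) ℝ).symm.differentiableAt.comp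
      (param n q) (((hs.neg.mul (hp.inv (phi_pos n _).ne')).smul hfst).prodMk ht)
  refine (DifferentiableAt.differentiableWithinAt key).congr_of_eventuallyEq_of_mem
    (Filter.mem_of_superset self_mem_nhdsWithin ?_) ⟨q, rfl⟩
  rintro _ ⟨⟨s, Θ⟩, rfl⟩
  have := (phi_pos n s).ne'
  rw [Set.mem_ofPred_eq, normal_param, paramNormal_eq hn]
  simp [param, height_psi, smul_smul, this]

/-- The parameterization with the spherical variable ranging over all of `ℝⁿ`. -/
def lift (n : ℕ) (s : ℝ) (x : EuclideanSpace ℝ (Fin n)) : Ambient n :=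
  WithLp.toLp 2 (phi n s • x, psi n s)

theorem lift_mem_surface (s : ℝ) {x : EuclideanSpace ℝ (Fin n)} (hx : ‖x‖ = 1) :
    lift n s x ∈ surface n := ⟨(s, ⟨x, by simpa using hx⟩), rfl⟩

theorem normal_lift (hn : 2 ≤ n) (s : ℝ) {x : EuclideanSpace ℝ (Fin n)} (hx : ‖x‖ = 1) :
    normal n (lift n s x) = WithLp.toLp 2 (-sech n s • x, th n s) :=
  (normal_param n (s, ⟨x, by simpa using hx⟩)).trans (paramNormal_eq hn _ _)

theorem hasDerivAt_toLp {x : ℝ → EuclideanSpace ℝ (Fin n)} {z : ℝ → ℝ}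
    {x' : EuclideanSpace ℝ (Fin n)} {z' t : ℝ} (hx : HasDerivAt x x' t) (hz : HasDerivAt z z' t) :
    HasDerivAt (fun r => (WithLp.toLp 2 (x r, z r) : Ambient n)) (WithLp.toLp 2 (x', z')) t := by
  let L : EuclideanSpace ℝ (Fin n) × ℝ →L[ℝ] Ambient n :=
    (WithLp.prodContinuousLinearEquiv 2 ℝ (EuclideanSpace ℝ (Fin n)) ℝ).symm.toContinuousLinearMap
  have h : HasDerivAt (fun r => L (x r, z r)) (L (x', z')) t :=
    L.hasFDerivAt.comp_hasDerivAt t (hx.prodMk hz)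
  exact h

/-- The vectors `N`, `φ⁻¹ ∂ₛ`, `φ⁻¹ eᵢ` at the point with parameters `(s, e none)`. -/
def frame (s : ℝ) (e : Option (Fin (n - 1)) → EuclideanSpace ℝ (Fin n)) :
    Option (Option (Fin (n - 1))) → Ambient n
  | none => WithLp.toLp 2 (-sech n s • e none, th n s)
  | some none => WithLp.toLp 2 (th n s • e none, sech n s)
  | some (some i) => WithLp.toLp 2 (e (some i), 0)

theorem orthonormal_frame (s : ℝ)
    {e : Option (Fin (n - 1)) → EuclideanSpace ℝ (Fin n)} (he : Orthonormal ℝ e) :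
    Orthonormal ℝ (frame s e) := by
  classical
  have h := orthonormal_iff_ite.1 he
  have hT := th_sq (n := n) s
  rw [orthonormal_iff_ite]
  rintro (_ | _ | i) (_ | _ | j) <;>
    simp only [frame, WithLp.prod_inner_apply, inner_smul_left, inner_smul_right, h] <;>
    simp <;> linarith

/-- `frame` as an orthonormal basis. -/
def frameBasis (hn : 2 ≤ n) (s : ℝ)
    (b : OrthonormalBasis (Option (Fin (n - 1))) ℝ (EuclideanSpace ℝ (Fin n))) :
    OrthonormalBasis (Option (Option (Fin (n - 1)))) ℝ (Ambient n) :=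
  OrthonormalBasis.mk (orthonormal_frame s b.orthonormal) (by
    refine (LinearIndependent.span_eq_top_of_card_eq_finrank'
      (orthonormal_frame s b.orthonormal).linearIndependent ?_).ge
    rw [(WithLp.linearEquiv 2 ℝ (EuclideanSpace ℝ (Fin n) × ℝ)).finrank_eq]
    simp
    omega)

theorem frameBasis_apply (hn : 2 ≤ n) (s : ℝ)
    (b : OrthonormalBasis (Option (Fin (n - 1))) ℝ (EuclideanSpace ℝ (Fin n)))
    (i : Option (Option (Fin (n - 1)))) : frameBasis hn s b i = frame s b i := by
  simp [frameBasis]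

theorem exists_orthonormalBasis (hn : 2 ≤ n) {x : EuclideanSpace ℝ (Fin n)} (hx : ‖x‖ = 1) :
    ∃ b : OrthonormalBasis (Option (Fin (n - 1))) ℝ (EuclideanSpace ℝ (Fin n)), b none = x := by
  have hon : Orthonormal ℝ (({none} : Set (Option (Fin (n - 1)))).domRestrict fun _ => x) :=
    ⟨fun _ => hx, fun i j hij => (hij (Subsingleton.elim i j)).elim⟩
  obtain ⟨b, hb⟩ := hon.exists_orthonormalBasis_extension_of_card_eq (by simp; omega)
  exact ⟨b, hb none rfl⟩

/-! ### Meridians and great circles on the catenoid -/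

section Curves

variable {x e : EuclideanSpace ℝ (Fin n)}

theorem norm_arc (hx : ‖x‖ = 1) (he : ‖e‖ = 1) (hxe : ⟪x, e⟫_ℝ = 0) (r : ℝ) :
    ‖Real.cos r • x + Real.sin r • e‖ = 1 := by
  have h : ‖Real.cos r • x + Real.sin r • e‖ ^ 2 = 1 := by
    rw [norm_add_sq_real, norm_smul, norm_smul, inner_smul_left, inner_smul_right, hxe, hx, he]
    simp
  rwa [pow_eq_one_iff_of_nonneg (norm_nonneg _) two_ne_zero] at h

theorem hasDerivAt_arc (r : ℝ) : HasDerivAt (fun r => Real.cos r • x + Real.sin r • e)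
    (-Real.sin r • x + Real.cos r • e) r :=
  ((Real.hasDerivAt_cos r).smul_const x).add ((Real.hasDerivAt_sin r).smul_const e)

theorem hasDerivAt_deriv_arc (r : ℝ) : HasDerivAt (fun r => -Real.sin r • x + Real.cos r • e)
    (-Real.cos r • x + -Real.sin r • e) r :=
  ((Real.hasDerivAt_sin r).neg.smul_const x).add ((Real.hasDerivAt_cos r).smul_const e)

theorem hasDerivAt_lift_left (hn : 2 ≤ n) (x : EuclideanSpace ℝ (Fin n)) (r : ℝ) :
    HasDerivAt (fun r => lift n r x)
      (WithLp.toLp 2 ((phi n r * th n r) • x, phi n r * sech n r)) r :=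
  hasDerivAt_toLp ((hasDerivAt_phi hn r).smul_const x) (hasDerivAt_psi hn r)

theorem hasDerivAt_deriv_lift_left (hn : 2 ≤ n) (x : EuclideanSpace ℝ (Fin n)) (r : ℝ) :
    HasDerivAt (fun r => (WithLp.toLp 2 ((phi n r * th n r) • x, phi n r * sech n r) : Ambient n))
      (WithLp.toLp 2 ((phi n r * th n r * th n r + phi n r * (((n : ℝ) - 1) * sech n r ^ 2)) • x,
        phi n r * th n r * sech n r + phi n r * (-((n : ℝ) - 1) * (sech n r * th n r)))) r :=
  hasDerivAt_toLp (((hasDerivAt_phi hn r).mul (hasDerivAt_th r)).smul_const x)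
    ((hasDerivAt_phi hn r).mul (hasDerivAt_sech r))

theorem hasDerivAt_lift_arc (s r : ℝ) :
    HasDerivAt (fun r => lift n s (Real.cos r • x + Real.sin r • e))
      (WithLp.toLp 2 (phi n s • (-Real.sin r • x + Real.cos r • e), 0)) r :=
  hasDerivAt_toLp ((hasDerivAt_arc r).const_smul (phi n s)) (hasDerivAt_const r _)

theorem hasDerivAt_deriv_lift_arc (s r : ℝ) :
    HasDerivAt (fun r => (WithLp.toLp 2
      (phi n s • (-Real.sin r • x + Real.cos r • e), 0) : Ambient n))
      (WithLp.toLp 2 (phi n s • (-Real.cos r • x + -Real.sin r • e), 0)) r :=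
  hasDerivAt_toLp ((hasDerivAt_deriv_arc r).const_smul (phi n s)) (hasDerivAt_const r _)

theorem inner_normal_deriv_lift_left (hn : 2 ≤ n) (hx : ‖x‖ = 1) (r : ℝ) :
    ⟪normal n (lift n r x),
      (WithLp.toLp 2 ((phi n r * th n r) • x, phi n r * sech n r) : Ambient n)⟫_ℝ = 0 := by
  rw [normal_lift hn r hx, WithLp.prod_inner_apply]
  simp [inner_smul_left, inner_smul_right, hx]
  ring

theorem inner_normal_deriv_lift_arc (hn : 2 ≤ n) (hx : ‖x‖ = 1) (he : ‖e‖ = 1)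
    (hxe : ⟪x, e⟫_ℝ = 0) (s r : ℝ) :
    ⟪normal n (lift n s (Real.cos r • x + Real.sin r • e)),
      (WithLp.toLp 2 (phi n s • (-Real.sin r • x + Real.cos r • e), 0) : Ambient n)⟫_ℝ = 0 := by
  rw [normal_lift hn s (norm_arc hx he hxe r), WithLp.prod_inner_apply]
  have hex : ⟪e, x⟫_ℝ = 0 := by rw [real_inner_comm, hxe]
  simp [inner_smul_left, inner_smul_right, inner_add_left, inner_add_right, hx, he, hxe, hex]
  ring

end Curves

/-! ### The Jacobi equation in the coordinates `(s, Θ)` -/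

section Equation

variable (b : OrthonormalBasis (Option (Fin (n - 1))) ℝ (EuclideanSpace ℝ (Fin n)))

theorem frame_mem_tangentConeAt (hn : 2 ≤ n) (s : ℝ) (i : Option (Fin (n - 1))) :
    phi n s • frame s b (some i) ∈ tangentConeAt ℝ (surface n) (lift n s (b none)) := by
  have hx := b.orthonormal.1 none
  rcases i with _ | i
  · convert Hypersurface.mem_tangentConeAt_of_curve (γ := fun r => lift n r (b none)) rfl
      (fun r => lift_mem_surface r hx) (hasDerivAt_lift_left hn (b none) s) using 1
    simp [frame, ← WithLp.toLp_smul, smul_smul]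
  · have he := b.orthonormal.1 (some i)
    have hxe : ⟪b none, b (some i)⟫_ℝ = 0 := b.orthonormal.2 (by simp)
    convert Hypersurface.mem_tangentConeAt_of_curve (t := 0)
      (p := lift n s (b none)) (γ := fun r => lift n s (Real.cos r • b none + Real.sin r • b (some i)))
      (by simp) (fun r => lift_mem_surface s (norm_arc hx he hxe r)) (hasDerivAt_lift_arc s 0) using 1
    simp [frame, ← WithLp.toLp_smul]

theorem frame_none (hn : 2 ≤ n) (s : ℝ) : frame s b none = normal n (lift n s (b none)) :=
  (normal_lift hn s (b.orthonormal.1 none)).symm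

theorem orthogonal_normal_le_span_tangentConeAt (hn : 2 ≤ n) {p : Ambient n} (hp : p ∈ surface n) :
    (ℝ ∙ normal n p)ᗮ ≤ Submodule.span ℝ (tangentConeAt ℝ (surface n) p) := by
  obtain ⟨⟨s, Θ⟩, rfl⟩ := hp
  obtain ⟨b, hb⟩ := exists_orthonormalBasis hn (x := (Θ : EuclideanSpace ℝ (Fin n)))
    (by simp)
  have hp : param n (s, Θ) = lift n s (b none) := by rw [hb]; rfl
  rw [hp]
  intro w hw
  rw [Submodule.mem_orthogonal_singleton_iff_inner_right, ← frame_none b hn] at hw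
  rw [← (frameBasis hn s b).sum_repr' w, Fintype.sum_option]
  simp only [frameBasis_apply, hw, zero_smul, zero_add]
  refine Submodule.sum_mem _ fun i _ => Submodule.smul_mem _ _ ?_
  have := Submodule.smul_mem _ (phi n s)⁻¹
    (Submodule.subset_span (R := ℝ) (frame_mem_tangentConeAt b hn s i))
  rwa [inv_smul_smul₀ (phi_pos n s).ne'] at this

theorem norm_normal (hn : 2 ≤ n) {p : Ambient n} (hp : p ∈ surface n) : ‖normal n p‖ = 1 := by
  obtain ⟨⟨s, Θ⟩, rfl⟩ := hp
  obtain ⟨b, hb⟩ := exists_orthonormalBasis hn (x := (Θ : EuclideanSpace ℝ (Fin n)))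
    (by simp)
  have hp : param n (s, Θ) = lift n s (b none) := by rw [hb]; rfl
  rw [hp, ← frame_none b hn]
  exact (orthonormal_frame s b.orthonormal).1 none

/-- Meridian and spherical directions are principal. The eigenvalues are `n-1` once and `-1` with
multiplicity `n-1`, times `sech / φ`; they sum to zero, as minimality requires. -/
theorem fderivWithin_normal_frame (hn : 2 ≤ n) (s : ℝ) (i : Option (Fin (n - 1))) :
    fderivWithin ℝ (normal n) (surface n) (lift n s (b none)) (frame s b (some i)) =
      ((i.elim ((n : ℝ) - 1) fun _ => -1) * (sech n s / phi n s)) • frame s b (some i) := by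
  have hx := b.orthonormal.1 none
  have hφ := (phi_pos n s).ne'
  have hd : DifferentiableWithinAt ℝ (normal n) (surface n) (lift n s (b none)) :=
    differentiableWithinAt_normal hn (s, ⟨b none, by simp⟩)
  -- The coordinate curves have velocity `φ` times a frame vector, so the derivative is computed on
  -- these multiples.
  suffices h : fderivWithin ℝ (normal n) (surface n) (lift n s (b none))
      (phi n s • frame s b (some i)) =
      ((i.elim ((n : ℝ) - 1) fun _ => -1) * sech n s) • frame s b (some i) by
    rw [map_smul] at h
    rw [← inv_smul_smul₀ hφ (fderivWithin ℝ (normal n) _ _ _), h, smul_smul]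
    congr 1
    field_simp
  rcases i with _ | i
  · have h := Hypersurface.fderivWithin_apply_of_curve hd
      (γ := fun r => lift n r (b none)) (t := s) rfl
      (fun r => lift_mem_surface r hx) (hasDerivAt_lift_left hn (b none) s)
      (v := WithLp.toLp 2 ((-(-((n : ℝ) - 1) * (sech n s * th n s))) • b none,
        ((n : ℝ) - 1) * sech n s ^ 2)) (by
        simp only [normal_lift hn _ hx]
        exact hasDerivAt_toLp ((hasDerivAt_sech s).neg.smul_const _) (hasDerivAt_th s))
    convert h using 1
    · simp [frame, ← WithLp.toLp_smul, smul_smul]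
    · simp [frame, ← WithLp.toLp_smul, smul_smul, mul_assoc, sq]
      rw [← neg_smul]
      congr 1
      ring
  · have he := b.orthonormal.1 (some i)
    have hxe : ⟪b none, b (some i)⟫_ℝ = 0 := b.orthonormal.2 (by simp)
    have h := Hypersurface.fderivWithin_apply_of_curve hd (t := 0)
      (γ := fun r => lift n s (Real.cos r • b none + Real.sin r • b (some i))) (by simp)
      (fun r => lift_mem_surface s (norm_arc hx he hxe r)) (hasDerivAt_lift_arc s 0)
      (v := WithLp.toLp 2 (-sech n s • (-Real.sin 0 • b none + Real.cos 0 • b (some i)), 0)) (by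
        simp only [normal_lift hn _ (norm_arc hx he hxe _)]
        exact hasDerivAt_toLp ((hasDerivAt_arc 0).fun_const_smul _) (hasDerivAt_const _ _))
    convert h using 1
    · simp [frame, ← WithLp.toLp_smul]
    · simp [frame, ← WithLp.toLp_smul, ← WithLp.toLp_neg]

/-- The squared eigenvalues add up to `(n-1)² + (n-1) = n(n-1)`. -/
theorem normSqSecondFundamentalForm_lift (hn : 2 ≤ n) (s : ℝ) :
    Hypersurface.normSqSecondFundamentalForm (surface n) (normal n) (lift n s (b none)) =
      n * ((n : ℝ) - 1) * sech n s ^ 2 / phi n s ^ 2 := by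
  have hb : frameBasis hn s b none = normal n (lift n s (b none)) := by
    rw [frameBasis_apply, frame_none b hn]
  have hon := orthonormal_frame s b.orthonormal
  have key : ∀ i : Option (Fin (n - 1)), ‖Hypersurface.tangentProj (normal n) (lift n s (b none))
      (fderivWithin ℝ (normal n) (surface n) (lift n s (b none)) (frameBasis hn s b (some i)))‖ ^ 2
      = (i.elim ((n : ℝ) - 1) fun _ => -1) ^ 2 * (sech n s / phi n s) ^ 2 := by
    intro i
    have h0 : ⟪normal n (lift n s (b none)), frame s b (some i)⟫_ℝ = 0 := by
      rw [← frame_none b hn]; exact hon.2 (by simp)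
    rw [frameBasis_apply, fderivWithin_normal_frame b hn, map_smul,
      Hypersurface.tangentProj_of_inner_eq_zero h0, norm_smul, hon.1, mul_one, Real.norm_eq_abs,
      sq_abs, mul_pow]
  rw [Hypersurface.normSqSecondFundamentalForm_eq_sum _ hb, Fintype.sum_congr _ _ key,
    Fintype.sum_option]
  have hc : ((n - 1 : ℕ) : ℝ) = (n : ℝ) - 1 := by
    rw [Nat.cast_sub (by omega)]; simp
  simp [hc]
  ring

/-- The equation `u_ss + (n-2) tanh((n-1)s) u_s + Δ_S u + n(n-1) φ²⁻²ⁿ u = 0` for functions on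
`ℝ × Sⁿ⁻¹`, where the Laplacian of the sphere is the sum of the second derivatives along
orthogonal great circles. -/
def SolvesJacobiEquation (n : ℕ) (u : ℝ → EuclideanSpace ℝ (Fin n) → ℝ) : Prop :=
  ∀ (s : ℝ) (b : OrthonormalBasis (Option (Fin (n - 1))) ℝ (EuclideanSpace ℝ (Fin n))),
    ∃ (u₁ u₂ : ℝ) (d₁ d₂ : Fin (n - 1) → ℝ),
      HasTwoJetAt (fun r => u r (b none)) u₁ u₂ s ∧
      (∀ i, HasTwoJetAt (fun r => u s (Real.cos r • b none + Real.sin r • b (some i)))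
        (d₁ i) (d₂ i) 0) ∧
      u₂ + ((n : ℝ) - 2) * th n s * u₁ + ∑ i, d₂ i
        + n * ((n : ℝ) - 1) * sech n s ^ 2 * u s (b none) = 0

theorem solvesJacobiEquation_of_isJacobiField (hn : 2 ≤ n) {f : Ambient n → ℝ}
    (hf : Hypersurface.IsJacobiField (surface n) (normal n) f) :
    SolvesJacobiEquation n fun s x => f (lift n s x) := by
  intro s b
  have hx := b.orthonormal.1 none
  have hxe : ∀ i, ⟪b none, b (some i)⟫_ℝ = 0 := fun i => b.orthonormal.2 (by simp)
  have hp : lift n s (b none) ∈ surface n := lift_mem_surface s hx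
  set V := Hypersurface.grad (surface n) (normal n) f with hVdef
  have hV : DifferentiableWithinAt ℝ V (surface n) (lift n s (b none)) :=
    Hypersurface.differentiableWithinAt_grad hf.1 hp (fun x hx => norm_normal hn hx)
      (differentiableWithinAt_normal hn (s, ⟨b none, by simp⟩))
      (fun x hx => orthogonal_normal_le_span_tangentConeAt hn hx)
  have hfd : DifferentiableOn ℝ f (surface n) := hf.1.differentiableOn (by simp)
  have j0 := Hypersurface.hasTwoJetAt_comp hfd (fun r => lift_mem_surface r hx)
    (hasDerivAt_lift_left hn (b none)) (inner_normal_deriv_lift_left hn hx)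
    (hasDerivAt_deriv_lift_left hn (b none) s) hV
  have ji := fun i : Fin (n - 1) => Hypersurface.hasTwoJetAt_comp (t := 0) hfd
    (fun r => lift_mem_surface s (norm_arc hx (b.orthonormal.1 (some i)) (hxe i) r))
    (hasDerivAt_lift_arc s)
    (inner_normal_deriv_lift_arc hn hx (b.orthonormal.1 (some i)) (hxe i) s)
    (hasDerivAt_deriv_lift_arc s 0) (by simpa using hV)
  refine ⟨_, _, _, _, j0, ji, ?_⟩
  have hJ := hf.2 _ hp
  have hb : frameBasis hn s b none = normal n (lift n s (b none)) := by
    rw [frameBasis_apply, frame_none b hn]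
  have hφ := (phi_pos n s).ne'
  rw [Hypersurface.jacobiOperator, normSqSecondFundamentalForm_lift b hn, Hypersurface.laplacian,
    Hypersurface.div_eq_sum _ hb, Fintype.sum_option] at hJ
  simp only [frameBasis_apply, ← hVdef] at hJ
  set D := fderivWithin ℝ V (surface n) (lift n s (b none)) with hD
  have h0 : (WithLp.toLp 2 ((phi n s * th n s) • b none, phi n s * sech n s) : Ambient n) =
      phi n s • frame s b (some none) := by
    simp [frame, ← WithLp.toLp_smul, smul_smul]
  have hi : ∀ i, (WithLp.toLp 2 (phi n s • b (some i), 0) : Ambient n) =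
      phi n s • frame s b (some (some i)) := fun i => by
    simp [frame, ← WithLp.toLp_smul]
  have hc : ((n - 1 : ℕ) : ℝ) = (n : ℝ) - 1 := by
    rw [Nat.cast_sub (by omega)]; simp
  -- The meridian acceleration splits into `n-1` times the radial vector, which cancels the
  -- accelerations of the `n-1` great circles, and a tangential part that produces the first-order
  -- term.
  have hacc : (WithLp.toLp 2 ((phi n s * th n s * th n s
        + phi n s * (((n : ℝ) - 1) * sech n s ^ 2)) • b none,
        phi n s * th n s * sech n s + phi n s * (-((n : ℝ) - 1) * (sech n s * th n s))) : Ambient n)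
      = ((n : ℝ) - 1) • WithLp.toLp 2 (phi n s • b none, 0)
        - (((n : ℝ) - 2) * th n s) • phi n s • frame s b (some none) := by
    have hT := th_sq (n := n) s
    simp only [frame, ← WithLp.toLp_smul, smul_smul, ← WithLp.toLp_sub, Prod.smul_mk,
      Prod.mk_sub_mk, ← sub_smul, smul_eq_mul]
    refine congrArg (WithLp.toLp 2) (Prod.ext ?_ ?_)
    · refine congrArg (· • b none) ?_
      linear_combination (((n : ℝ) - 1) * phi n s) * hT
    · simp only
      ring
  simp only [Real.sin_zero, Real.cos_zero, neg_zero, zero_smul, zero_add, one_smul, add_zero,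
    neg_smul, smul_neg, h0, hi, hacc]
  have hneg : (WithLp.toLp 2 (-(phi n s • b none), 0) : Ambient n) =
      -WithLp.toLp 2 (phi n s • b none, 0) := by
    simp [← WithLp.toLp_neg]
  rw [hneg]
  have hcomm : ∀ v, ⟪v, D v⟫_ℝ = ⟪D v, v⟫_ℝ := fun v => real_inner_comm _ _
  simp only [map_smul, inner_smul_left, inner_smul_right, inner_sub_right, inner_neg_right,
    Finset.sum_add_distrib, Finset.sum_const, Finset.card_univ, Fintype.card_fin, nsmul_eq_mul,
    hc, conj_trivial, ← Finset.mul_sum, hcomm] at hJ ⊢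
  have hB : phi n s ^ 2 * (n * ((n : ℝ) - 1) * sech n s ^ 2 / phi n s ^ 2 * f (lift n s (b none)))
      = n * ((n : ℝ) - 1) * sech n s ^ 2 * f (lift n s (b none)) := by
    field_simp
  linear_combination phi n s ^ 2 * hJ - hB

end Equation

/-! ### Solutions of the Jacobi equation that vanish at the ends -/

/-- A continuous solution of the Jacobi equation on `ℝ × Sⁿ⁻¹` that tends to `0` at both ends. -/
structure IsVanishingSolution (n : ℕ) (u : ℝ → EuclideanSpace ℝ (Fin n) → ℝ) : Prop where
  solves : SolvesJacobiEquation n u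
  continuousOn : ContinuousOn (fun q : ℝ × EuclideanSpace ℝ (Fin n) => u q.1 q.2)
    (Set.univ ×ˢ Metric.sphere 0 1)
  vanishes : ∀ ε > 0, ∃ R : ℝ, ∀ s x, ‖x‖ = 1 → R ≤ |s| → |u s x| < ε

namespace IsVanishingSolution

variable {u v : ℝ → EuclideanSpace ℝ (Fin n) → ℝ}

theorem sub (hu : IsVanishingSolution n u) (hv : IsVanishingSolution n v) :
    IsVanishingSolution n fun s x => u s x - v s x where
  solves s b := by
    obtain ⟨u₁, u₂, c₁, c₂, h1, h2, h3⟩ := hu.solves s b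
    obtain ⟨v₁, v₂, d₁, d₂, k1, k2, k3⟩ := hv.solves s b
    refine ⟨_, _, _, _, h1.sub k1, fun i => (h2 i).sub (k2 i), ?_⟩
    rw [Finset.sum_sub_distrib]
    linear_combination h3 - k3
  continuousOn := hu.continuousOn.sub hv.continuousOn
  vanishes ε hε := by
    obtain ⟨R, hR⟩ := hu.vanishes (ε / 2) (half_pos hε)
    obtain ⟨R', hR'⟩ := hv.vanishes (ε / 2) (half_pos hε)
    refine ⟨max R R', fun s x hx hs => ?_⟩
    have h1 := hR s x hx ((le_max_left _ _).trans hs)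
    have h2 := hR' s x hx ((le_max_right _ _).trans hs)
    linarith [abs_sub (u s x) (v s x)]

/-- The equation is required for every orthonormal basis, so it is invariant under linear
isometries. -/
theorem comp (hu : IsVanishingSolution n u)
    (R : EuclideanSpace ℝ (Fin n) ≃ₗᵢ[ℝ] EuclideanSpace ℝ (Fin n)) :
    IsVanishingSolution n fun s x => u s (R x) where
  solves s b := by
    simpa using hu.solves s (b.map R)
  continuousOn := hu.continuousOn.comp (f := fun q : ℝ × EuclideanSpace ℝ (Fin n) => (q.1, R q.2))
    (by fun_prop) (fun q hq => by simpa using hq)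
  vanishes ε hε := by
    obtain ⟨r, hr⟩ := hu.vanishes ε hε
    exact ⟨r, fun s x hx hs => hr s (R x) (by simpa using hx) hs⟩

end IsVanishingSolution

/-! ### A positive strict supersolution on a quarter of the catenoid -/

/-- A function on the quarter sphere, in terms of two orthogonal coordinates, with
`Δ A + (n-1) A ≤ -4`. -/
def quarterProfile (n : ℕ) (X Y : ℝ) : ℝ :=
  X + Y + 3 / 2 * ((n : ℝ) + 3) * (X * Y) - (X ^ 2 + Y ^ 2) - ((n : ℝ) + 1) / 2 * (X ^ 2 * Y ^ 2)

theorem quarterProfile_nonneg {X Y : ℝ} (hX : 0 ≤ X) (hY : 0 ≤ Y) (hX1 : X ≤ 1) (hY1 : Y ≤ 1) :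
    0 ≤ quarterProfile n X Y := by
  have hn : (0 : ℝ) ≤ n := n.cast_nonneg
  have h1 : X ^ 2 ≤ X := by nlinarith
  have h2 : Y ^ 2 ≤ Y := by nlinarith
  have h0 : 0 ≤ X * Y := mul_nonneg hX hY
  have h3 : X ^ 2 * Y ^ 2 ≤ X * Y := mul_le_mul h1 h2 (sq_nonneg _) hX
  have h4 : ((n : ℝ) + 1) / 2 * (X ^ 2 * Y ^ 2) ≤ 3 / 2 * ((n : ℝ) + 3) * (X * Y) :=
    mul_le_mul (by linarith) h3 (by positivity) (by positivity)
  rw [quarterProfile]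
  linarith

/-- The second derivative of `quarterProfile` along a great circle with initial velocity having
coordinates `α`, `β`. -/
def quarterProfileSecond (n : ℕ) (X Y α β : ℝ) : ℝ :=
  -X - Y + 3 / 2 * ((n : ℝ) + 3) * (2 * (α * β) - 2 * (X * Y))
    - (2 * α ^ 2 - 2 * X ^ 2 + (2 * β ^ 2 - 2 * Y ^ 2))
    - ((n : ℝ) + 1) / 2 * (2 * α ^ 2 * Y ^ 2 + 2 * X ^ 2 * β ^ 2 + 8 * (α * β) * (X * Y)
      - 4 * (X ^ 2 * Y ^ 2))

theorem hasTwoJetAt_quarterProfile (n : ℕ) (X Y α β : ℝ) :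
    ∃ g₁, HasTwoJetAt (fun r => quarterProfile n (Real.cos r * X + Real.sin r * α)
      (Real.cos r * Y + Real.sin r * β)) g₁ (quarterProfileSecond n X Y α β) 0 := by
  have d1 : ∀ X α r : ℝ, HasDerivAt (fun r => Real.cos r * X + Real.sin r * α)
      (-Real.sin r * X + Real.cos r * α) r := fun X α r =>
    ((Real.hasDerivAt_cos r).mul_const X).add ((Real.hasDerivAt_sin r).mul_const α)
  have d2 : ∀ X α r : ℝ, HasDerivAt (fun r => -Real.sin r * X + Real.cos r * α)
      (-Real.cos r * X + -Real.sin r * α) r := fun X α r =>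
    ((Real.hasDerivAt_sin r).neg.mul_const X).add ((Real.hasDerivAt_cos r).mul_const α)
  refine ⟨_, HasTwoJetAt.of_hasDerivAt (fun r => (((((d1 X α r).add (d1 Y β r)).add
    (((d1 X α r).mul (d1 Y β r)).const_mul (3 / 2 * ((n : ℝ) + 3)))).sub
    (((d1 X α r).pow 2).add ((d1 Y β r).pow 2))).sub
    ((((d1 X α r).pow 2).mul ((d1 Y β r).pow 2)).const_mul (((n : ℝ) + 1) / 2)))) ?_⟩
  have e1 := d1 X α 0
  have e2 := d1 Y β 0
  have f1 := d2 X α 0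
  have f2 := d2 Y β 0
  -- The exponents `2 - 1` match the form in which `HasDerivAt.pow` leaves the first derivative.
  refine HasDerivAt.congr_deriv ((((f1.add f2).add
    (((f1.mul e2).add (e1.mul f2)).const_mul (3 / 2 * ((n : ℝ) + 3)))).sub
    ((((e1.pow (2 - 1)).const_mul _).mul f1).add (((e2.pow (2 - 1)).const_mul _).mul f2))).sub
    ((((((e1.pow (2 - 1)).const_mul _).mul f1).mul (e2.pow 2)).add
      ((e1.pow 2).mul (((e2.pow (2 - 1)).const_mul _).mul f2))).const_mul
        (((n : ℝ) + 1) / 2))) ?_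
  simp [quarterProfileSecond]
  ring

/-- Write `L = Δ_S + (n-1)`. Then `L X = L Y = 0`, `L(XY) = -(n+1)XY`, `L(X²) = 2 - (n+1)X²` and
`L(X²Y²) = 2(X²+Y²) - 3(n+3)X²Y²`. The coefficients of the profile cancel the terms in `X² + Y²` and
leave exactly `-4 - 3/2 (n+1)(n+3) XY(1 - XY)`. -/
theorem sum_quarterProfileSecond_le (hn : 2 ≤ n) {X Y : ℝ} (hX : 0 ≤ X) (hY : 0 ≤ Y)
    (hX1 : X ≤ 1) (hY1 : Y ≤ 1) {α β : Fin (n - 1) → ℝ} (hα : ∑ i, α i ^ 2 = 1 - X ^ 2)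
    (hβ : ∑ i, β i ^ 2 = 1 - Y ^ 2) (hαβ : ∑ i, α i * β i = -(X * Y)) :
    ∑ i, quarterProfileSecond n X Y (α i) (β i) + ((n : ℝ) - 1) * quarterProfile n X Y ≤ -4 := by
  have hc : ((n - 1 : ℕ) : ℝ) = (n : ℝ) - 1 := by
    rw [Nat.cast_sub (by omega)]; simp
  have hn0 : (0 : ℝ) ≤ n := n.cast_nonneg
  have h1 : X * Y ≤ 1 := mul_le_one₀ hX1 hY hY1
  have h0 : 0 ≤ X * Y := mul_nonneg hX hY
  have hsum : ∑ i, quarterProfileSecond n X Y (α i) (β i) =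
      ((n : ℝ) - 1) * (-X - Y - 3 * ((n : ℝ) + 3) * (X * Y) + 2 * X ^ 2 + 2 * Y ^ 2
        + 2 * ((n : ℝ) + 1) * (X ^ 2 * Y ^ 2))
      + 3 * ((n : ℝ) + 3) * ∑ i, α i * β i - 2 * ∑ i, α i ^ 2 - 2 * ∑ i, β i ^ 2
      - ((n : ℝ) + 1) * (Y ^ 2 * ∑ i, α i ^ 2 + X ^ 2 * ∑ i, β i ^ 2
        + 4 * (X * Y) * ∑ i, α i * β i) := by
    have hcard : ∀ z : ℝ, ((n : ℝ) - 1) * z = ∑ _i : Fin (n - 1), z := fun z => by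
      rw [Finset.sum_const, Finset.card_univ, Fintype.card_fin, nsmul_eq_mul, hc]
    rw [hcard]
    simp only [Finset.mul_sum, ← Finset.sum_add_distrib, ← Finset.sum_sub_distrib]
    refine Finset.sum_congr rfl fun i _ => ?_
    rw [quarterProfileSecond]
    ring
  rw [hsum, hα, hβ, hαβ, quarterProfile]
  have h2 : 0 ≤ 3 / 2 * ((n : ℝ) + 1) * ((n : ℝ) + 3) * (X * Y) * (1 - X * Y) :=
    mul_nonneg (by positivity) (by linarith)
  nlinarith [h2]

/-- The supersolution `φ¹⁻ⁿ A + ε` in terms of the coordinates along `a` and `b`. -/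
def barrier (n : ℕ) (a b : EuclideanSpace ℝ (Fin n)) (s : ℝ) (x : EuclideanSpace ℝ (Fin n)) : ℝ :=
  sech n s * quarterProfile n ⟪x, a⟫_ℝ ⟪x, b⟫_ℝ + ((n : ℝ) * ((n : ℝ) - 1))⁻¹

theorem hasTwoJetAt_sech (s : ℝ) : HasTwoJetAt (sech n) (-((n : ℝ) - 1) * (sech n s * th n s))
    (((n : ℝ) - 1) ^ 2 * (sech n s * th n s ^ 2 - sech n s ^ 3)) s := by
  refine HasTwoJetAt.of_hasDerivAt hasDerivAt_sech ?_
  refine (((hasDerivAt_sech s).mul (hasDerivAt_th s)).const_mul (-((n : ℝ) - 1))).congr_deriv ?_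
  ring

theorem sum_inner_mul_inner_some {ι : Type*} [Fintype ι] {E : Type*} [NormedAddCommGroup E]
    [InnerProductSpace ℝ E] (e : OrthonormalBasis (Option ι) ℝ E) (a b : E) :
    ∑ i, ⟪e (some i), a⟫_ℝ * ⟪e (some i), b⟫_ℝ = ⟪a, b⟫_ℝ - ⟪e none, a⟫_ℝ * ⟪e none, b⟫_ℝ := by
  have h := e.sum_inner_mul_inner a b
  rw [Fintype.sum_option] at h
  simp only [real_inner_comm _ a] at h ⊢
  linarith

/-- The Jacobi operator of `barrier` is negative where both coordinates are nonnegative. -/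
theorem exists_jets_barrier (hn : 2 ≤ n) {a b : EuclideanSpace ℝ (Fin n)} (ha : ‖a‖ = 1)
    (hb : ‖b‖ = 1) (hab : ⟪a, b⟫_ℝ = 0) (s : ℝ)
    (e : OrthonormalBasis (Option (Fin (n - 1))) ℝ (EuclideanSpace ℝ (Fin n)))
    (hxa : 0 ≤ ⟪e none, a⟫_ℝ) (hxb : 0 ≤ ⟪e none, b⟫_ℝ) :
    ∃ (w₁ w₂ : ℝ) (d₁ d₂ : Fin (n - 1) → ℝ),
      HasTwoJetAt (fun r => barrier n a b r (e none)) w₁ w₂ s ∧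
      (∀ i, HasTwoJetAt (fun r => barrier n a b s (Real.cos r • e none + Real.sin r • e (some i)))
        (d₁ i) (d₂ i) 0) ∧
      w₂ + ((n : ℝ) - 2) * th n s * w₁ + ∑ i, d₂ i
        + n * ((n : ℝ) - 1) * sech n s ^ 2 * barrier n a b s (e none) < 0 := by
  have hn2 : (2 : ℝ) ≤ n := by exact_mod_cast hn
  have hx := e.orthonormal.1 none
  set X := ⟪e none, a⟫_ℝ with hX
  set Y := ⟪e none, b⟫_ℝ with hY
  have hX1 : X ≤ 1 := by simpa [hx, ha] using real_inner_le_norm (e none) a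
  have hY1 : Y ≤ 1 := by simpa [hx, hb] using real_inner_le_norm (e none) b
  have hA := sum_quarterProfileSecond_le hn hxa hxb hX1 hY1
    (α := fun i => ⟪e (some i), a⟫_ℝ) (β := fun i => ⟪e (some i), b⟫_ℝ)
    (by simp only [sq, sum_inner_mul_inner_some]; simp [ha, hX])
    (by simp only [sq, sum_inner_mul_inner_some]; simp [hb, hY])
    (by rw [sum_inner_mul_inner_some, hab]; ring)
  have const_jet : ∀ c t : ℝ, HasTwoJetAt (fun _ => c) 0 0 t := fun c t =>
    HasTwoJetAt.of_hasDerivAt (fun r => hasDerivAt_const r c) (hasDerivAt_const t 0)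
  choose g₁ hg using fun i : Fin (n - 1) =>
    hasTwoJetAt_quarterProfile n X Y ⟪e (some i), a⟫_ℝ ⟪e (some i), b⟫_ℝ
  refine ⟨quarterProfile n X Y * (-((n : ℝ) - 1) * (sech n s * th n s)),
    quarterProfile n X Y * (((n : ℝ) - 1) ^ 2 * (sech n s * th n s ^ 2 - sech n s ^ 3)),
    fun i => sech n s * g₁ i,
    fun i => sech n s * quarterProfileSecond n X Y ⟪e (some i), a⟫_ℝ ⟪e (some i), b⟫_ℝ,
    ?_, fun i => ?_, ?_⟩
  · convert ((hasTwoJetAt_sech s).const_mul (quarterProfile n X Y)).add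
      (const_jet ((n : ℝ) * ((n : ℝ) - 1))⁻¹ s) using 1
    · ext r; rw [barrier, mul_comm]
    · ring
    · ring
  · convert ((hg i).const_mul (sech n s)).add (const_jet ((n : ℝ) * ((n : ℝ) - 1))⁻¹ 0) using 1
    · ext r
      simp [barrier, inner_add_left, inner_smul_left, hX, hY]
    · ring
    · ring
  · rw [← Finset.mul_sum, barrier, ← hX, ← hY]
    have hq := sech_pos (n := n) s
    have hq1 := sech_le_one (n := n) s
    have hT := th_sq (n := n) s
    have hε : (n : ℝ) * ((n : ℝ) - 1) * ((n : ℝ) * ((n : ℝ) - 1))⁻¹ = 1 :=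
      mul_inv_cancel₀ (mul_pos (by linarith) (by linarith)).ne'
    generalize ((n : ℝ) * ((n : ℝ) - 1))⁻¹ = ε at hε ⊢
    have h1 := mul_le_mul_of_nonneg_left hA hq.le
    generalize (∑ i, quarterProfileSecond n X Y ⟪e (some i), a⟫_ℝ ⟪e (some i), b⟫_ℝ) = Z at h1 ⊢
    generalize quarterProfile n X Y = A at h1 ⊢
    generalize sech n s = q at *
    generalize th n s = T at *
    -- The factor `q = sech` comes from horizontal translations: the Jacobi operator takes `q A` to
    -- `q (Δ_S A + (n-1) A) ≤ -4q`. The constant adds `n(n-1) q² ε = q² ≤ q`, so the sum stays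
    -- negative.
    have key : A * (((n : ℝ) - 1) ^ 2 * (q * T ^ 2 - q ^ 3))
        + ((n : ℝ) - 2) * T * (A * (-((n : ℝ) - 1) * (q * T))) + q * Z
        + n * ((n : ℝ) - 1) * q ^ 2 * (q * A + ε) = q * (Z + ((n : ℝ) - 1) * A) + q ^ 2 := by
      linear_combination (((n : ℝ) - 1) * A * q) * hT + q ^ 2 * hε
    rw [key]
    nlinarith

/-- The added constant keeps the supersolution away from zero at the ends and on the walls, so that
any decaying function is eventually below a positive multiple of it. -/
theorem barrier_ge {a b x : EuclideanSpace ℝ (Fin n)} (ha : ‖a‖ = 1)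
    (hb : ‖b‖ = 1) (s : ℝ) (hx : ‖x‖ = 1) (hxa : 0 ≤ ⟪x, a⟫_ℝ) (hxb : 0 ≤ ⟪x, b⟫_ℝ) :
    ((n : ℝ) * ((n : ℝ) - 1))⁻¹ ≤ barrier n a b s x := by
  have h := quarterProfile_nonneg (n := n) hxa hxb
    (by simpa [hx, ha] using real_inner_le_norm x a)
    (by simpa [hx, hb] using real_inner_le_norm x b)
  have := mul_nonneg (sech_pos (n := n) s).le h
  rw [barrier]
  linarith

theorem continuous_barrier (a b : EuclideanSpace ℝ (Fin n)) :
    Continuous fun q : ℝ × EuclideanSpace ℝ (Fin n) => barrier n a b q.1 q.2 := by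
  have := continuous_sech (n := n)
  unfold barrier quarterProfile
  fun_prop

/-- The maximum principle on a quarter of the catenoid. -/
theorem IsVanishingSolution.nonpos_of_quarter (hn : 2 ≤ n)
    {v : ℝ → EuclideanSpace ℝ (Fin n) → ℝ} (hv : IsVanishingSolution n v)
    {a b : EuclideanSpace ℝ (Fin n)} (ha : ‖a‖ = 1) (hb : ‖b‖ = 1) (hab : ⟪a, b⟫_ℝ = 0)
    (hva : ∀ s x, ‖x‖ = 1 → ⟪x, a⟫_ℝ = 0 → v s x = 0)
    (hvb : ∀ s x, ‖x‖ = 1 → ⟪x, b⟫_ℝ = 0 → v s x = 0)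
    {s : ℝ} {x : EuclideanSpace ℝ (Fin n)} (hx : ‖x‖ = 1)
    (hxa : 0 ≤ ⟪x, a⟫_ℝ) (hxb : 0 ≤ ⟪x, b⟫_ℝ) : v s x ≤ 0 := by
  by_contra! hpos
  have hn2 : (2 : ℝ) ≤ n := by exact_mod_cast hn
  set ε := ((n : ℝ) * ((n : ℝ) - 1))⁻¹ with hε
  have hε0 : 0 < ε := inv_pos.2 (mul_pos (by linarith) (by linarith))
  set W := barrier n a b with hW
  have hWε : ∀ s x, ‖x‖ = 1 → 0 ≤ ⟪x, a⟫_ℝ → 0 ≤ ⟪x, b⟫_ℝ → ε ≤ W s x :=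
    fun s x hx h1 h2 => barrier_ge ha hb s hx h1 h2
  have hW0 := fun s x hx h1 h2 => hε0.trans_le (hWε s x hx h1 h2)
  set c₀ := v s x / W s x with hc₀
  have hc₀pos : 0 < c₀ := div_pos hpos (hW0 s x hx hxa hxb)
  obtain ⟨R, hR⟩ := hv.vanishes (c₀ * ε) (mul_pos hc₀pos hε0)
  have hfar : ∀ t y, ‖y‖ = 1 → 0 ≤ ⟪y, a⟫_ℝ → 0 ≤ ⟪y, b⟫_ℝ → R ≤ |t| → v t y < c₀ * W t y :=
    fun t y hy h1 h2 ht => (le_abs_self _).trans_lt ((hR t y hy ht).trans_le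
      (mul_le_mul_of_nonneg_left (hWε t y hy h1 h2) hc₀pos.le))
  have hsR : |s| < R := by
    by_contra! h
    have := hfar s x hx hxa hxb h
    rw [hc₀, div_mul_cancel₀ _ (hW0 s x hx hxa hxb).ne'] at this
    exact lt_irrefl _ this
  set Q : Set (EuclideanSpace ℝ (Fin n)) :=
    Metric.sphere 0 1 ∩ {y | 0 ≤ ⟪y, a⟫_ℝ ∧ 0 ≤ ⟪y, b⟫_ℝ} with hQ
  have hQc : IsCompact Q := by
    have hcl : ∀ z : EuclideanSpace ℝ (Fin n),
        IsClosed {y : EuclideanSpace ℝ (Fin n) | 0 ≤ ⟪y, z⟫_ℝ} := fun z =>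
      isClosed_le continuous_const (by fun_prop)
    exact (isCompact_sphere 0 1).inter_right ((hcl a).inter (hcl b))
  have hQm : ∀ y ∈ Q, ‖y‖ = 1 ∧ 0 ≤ ⟪y, a⟫_ℝ ∧ 0 ≤ ⟪y, b⟫_ℝ := fun y hy =>
    ⟨by simpa using hy.1, hy.2⟩
  have hxK : (s, x) ∈ Set.Icc (-R) R ×ˢ Q :=
    ⟨abs_le.1 hsR.le, by simpa using hx, hxa, hxb⟩
  -- Maximizing the ratio `v / W` makes the zeroth-order terms of `v` and `c W` agree at the
  -- maximum, so the sign of the potential does not matter.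
  obtain ⟨⟨t, y⟩, hty, hmax⟩ := ((isCompact_Icc (a := -R) (b := R)).prod hQc).exists_isMaxOn
    ⟨_, hxK⟩ (f := fun q => v q.1 q.2 / W q.1 q.2)
    ((hv.continuousOn.mono fun q hq => ⟨trivial, hq.2.1⟩).div
      (continuous_barrier a b).continuousOn fun q hq => by
        obtain ⟨h1, h2, h3⟩ := hQm _ hq.2
        exact (hW0 q.1 q.2 h1 h2 h3).ne')
  obtain ⟨hy, hya, hyb⟩ := hQm y hty.2
  set c := v t y / W t y with hc
  have hcc : c₀ ≤ c := hmax hxK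
  have hcpos : 0 < c := hc₀pos.trans_le hcc
  have hvc : v t y = c * W t y := (div_mul_cancel₀ _ (hW0 t y hy hya hyb).ne').symm
  -- Beyond `R` decay gives `v < c₀ W`, so the maximum over the compact piece is global and `t` may
  -- even be an endpoint.
  have hle : ∀ r z, ‖z‖ = 1 → 0 ≤ ⟪z, a⟫_ℝ → 0 ≤ ⟪z, b⟫_ℝ → v r z ≤ c * W r z := by
    intro r z hz h1 h2
    rcases le_total R |r| with h | h
    · exact (hfar r z hz h1 h2 h).le.trans
        (mul_le_mul_of_nonneg_right hcc (hW0 r z hz h1 h2).le)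
    · have : v r z / W r z ≤ c :=
        hmax (show (r, z) ∈ Set.Icc (-R) R ×ˢ Q from ⟨abs_le.1 h, by simpa using hz, h1, h2⟩)
      rwa [div_le_iff₀ (hW0 r z hz h1 h2)] at this
  have hvpos : 0 < v t y := hvc ▸ mul_pos hcpos (hW0 t y hy hya hyb)
  -- Since `v` vanishes on both walls and is positive at `y`, short great-circle arcs through `y`
  -- remain in the quarter.
  have hya' : 0 < ⟪y, a⟫_ℝ := hya.lt_of_ne fun h => hvpos.ne' (hva t y hy h.symm)
  have hyb' : 0 < ⟪y, b⟫_ℝ := hyb.lt_of_ne fun h => hvpos.ne' (hvb t y hy h.symm)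
  obtain ⟨e, rfl⟩ := exists_orthonormalBasis hn hy
  obtain ⟨v₁, v₂, k₁, k₂, h1, h2, h3⟩ := hv.solves t e
  obtain ⟨w₁, w₂, d₁, d₂, j1, j2, j3⟩ := exists_jets_barrier hn ha hb hab t e hya hyb
  have hs := h1.sub (j1.const_mul c)
  have hsmax : IsLocalMax (fun r => v r (e none) - c * W r (e none)) t :=
    Eventually.of_forall fun r => by
      have := hle r (e none) hy hya hyb
      linarith
  have hv1 := hs.first_eq_zero hsmax
  have hv2 := hs.second_nonpos hsmax
  have hd : ∀ i, k₂ i ≤ c * d₂ i := fun i => by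
    refine sub_nonpos.1 (((h2 i).sub ((j2 i).const_mul c)).second_nonpos ?_)
    have hei : ⟪e none, e (some i)⟫_ℝ = 0 := e.orthonormal.2 (by simp)
    have hca : ∀ z : EuclideanSpace ℝ (Fin n), 0 < ⟪e none, z⟫_ℝ →
        ∀ᶠ r in 𝓝 (0 : ℝ), 0 < ⟪Real.cos r • e none + Real.sin r • e (some i), z⟫_ℝ := by
      intro z hz
      have : Continuous fun r : ℝ => ⟪Real.cos r • e none + Real.sin r • e (some i), z⟫_ℝ := by
        fun_prop
      exact continuous_const.continuousAt.eventually_lt this.continuousAt (by simpa using hz)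
    filter_upwards [hca a hya', hca b hyb'] with r hra hrb
    have := hle t _ (norm_arc hy (e.orthonormal.1 (some i)) hei r) hra.le hrb.le
    simp only [Real.cos_zero, Real.sin_zero, one_smul, zero_smul, add_zero]
    linarith
  have hsum : ∑ i, k₂ i ≤ c * ∑ i, d₂ i := by
    rw [Finset.mul_sum]
    exact Finset.sum_le_sum fun i _ => hd i
  have := mul_neg_of_pos_of_neg hcpos j3
  rw [hvc] at h3
  have hv1' : v₁ = c * w₁ := by linarith
  rw [hv1'] at h3
  -- At the maximum the operator applied to `v - c W` is at most `0`, whereas it equals `-c` times a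
  -- negative number.
  nlinarith

/-! ### Even vanishing solutions are rotationally symmetric -/

theorem IsVanishingSolution.le_of_even (hn : 2 ≤ n) {u : ℝ → EuclideanSpace ℝ (Fin n) → ℝ}
    (hu : IsVanishingSolution n u) (heven : ∀ s x, ‖x‖ = 1 → u s (-x) = u s x) (s : ℝ)
    {x y : EuclideanSpace ℝ (Fin n)} (hx : ‖x‖ = 1) (hy : ‖y‖ = 1) : u s x ≤ u s y := by
  rcases eq_or_ne x y with rfl | hne
  · exact le_rfl
  rcases eq_or_ne x (-y) with rfl | hne'
  · exact (heven s y hy).le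
  set d := x - y with hd
  set e := x - -y with he
  have hd0 : 0 < ‖d‖ := norm_pos_iff.2 (sub_ne_zero.2 hne)
  have he0 : 0 < ‖e‖ := norm_pos_iff.2 (sub_ne_zero.2 hne')
  have hde : ⟪d, e⟫_ℝ = 0 := by
    rw [hd, he, sub_neg_eq_add, inner_sub_left, inner_add_right, inner_add_right,
      real_inner_self_eq_norm_sq, real_inner_self_eq_norm_sq, hx, hy, real_inner_comm x y]
    ring
  have hxy : ⟪x, y⟫_ℝ ≤ 1 := by simpa [hx, hy] using real_inner_le_norm x y
  have hxy' : -1 ≤ ⟪x, y⟫_ℝ := by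
    have := neg_le_of_abs_le (abs_real_inner_le_norm x y)
    simpa [hx, hy] using this
  have hxd : 0 ≤ ⟪x, d⟫_ℝ := by
    rw [hd, inner_sub_right, real_inner_self_eq_norm_sq, hx]; linarith
  have hxe : 0 ≤ ⟪x, e⟫_ℝ := by
    rw [he, sub_neg_eq_add, inner_add_right, real_inner_self_eq_norm_sq, hx]; linarith
  set P := (ℝ ∙ d)ᗮ.reflection with hP
  set Q := (ℝ ∙ e)ᗮ.reflection with hQ
  have hfix : ∀ z w : EuclideanSpace ℝ (Fin n), ⟪w, z⟫_ℝ = 0 → (ℝ ∙ w)ᗮ.reflection z = z :=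
    fun z w h => Submodule.reflection_mem_subspace_eq_self
      (Submodule.mem_orthogonal_singleton_iff_inner_right.2 h)
  have hPx : P x = y := Submodule.reflection_sub (by rw [hx, hy])
  have hQx : Q x = -y := Submodule.reflection_sub (by rw [norm_neg, hx, hy])
  have hPy : P y = x := by rw [← hPx, hP, Submodule.reflection_reflection]
  -- Odd under `Q` by construction, and under `P` because the two reflections have orthogonal axes.
  have hv := (hu.sub (hu.comp P)).sub ((hu.sub (hu.comp P)).comp Q)
  have key := hv.nonpos_of_quarter hn (a := ‖d‖⁻¹ • d) (b := ‖e‖⁻¹ • e) (s := s)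
    (norm_smul_inv_norm (𝕜 := ℝ) (norm_pos_iff.1 hd0))
    (norm_smul_inv_norm (𝕜 := ℝ) (norm_pos_iff.1 he0))
    (by rw [inner_smul_left, inner_smul_right, hde]; simp)
    (fun r z hz h => by
      have h0 : ⟪d, z⟫_ℝ = 0 := by
        rw [inner_smul_right, real_inner_comm] at h
        exact (mul_eq_zero.1 h).resolve_left (inv_pos.2 hd0).ne'
      have h1 : ⟪d, Q z⟫_ℝ = 0 := by
        -- `Q` fixes `d` and so preserves the mirror of `P`; both `z` and `Q z` are then fixed by
        -- `P`.
        have hQd : Q d = d := hfix d e (by rw [real_inner_comm, hde])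
        rw [← hQd, LinearIsometryEquiv.inner_map_map, h0]
      simp only [hP, hfix _ _ h0, hfix _ _ h1]
      ring)
    (fun r z hz h => by
      have h0 : ⟪e, z⟫_ℝ = 0 := by
        rw [inner_smul_right, real_inner_comm] at h
        exact (mul_eq_zero.1 h).resolve_left (inv_pos.2 he0).ne'
      simp only [hQ, hfix _ _ h0]
      ring)
    hx (by rw [inner_smul_right]; positivity) (by rw [inner_smul_right]; positivity)
  -- Here `v(x) = u(x) - u(y) - u(-y) + u(-x)`, which evenness turns into `2(u(x) - u(y))`.
  simp only [hPx, hQx, map_neg, hPy, heven s x hx, heven s y hy] at key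
  linarith

/-! ### Rotationally symmetric solutions -/

/-- The Jacobi field generated by dilations. -/
def dilationField (n : ℕ) (s : ℝ) : ℝ := psi n s * th n s - phi n s * sech n s

theorem hasDerivAt_phi_mul_sech (hn : 2 ≤ n) (s : ℝ) : HasDerivAt (fun s => phi n s * sech n s)
    ((2 - (n : ℝ)) * th n s * (phi n s * sech n s)) s :=
  ((hasDerivAt_phi hn s).mul (hasDerivAt_sech s)).congr_deriv (by ring)

theorem hasDerivAt_dilationField (hn : 2 ≤ n) (s : ℝ) : HasDerivAt (dilationField n)
    (((n : ℝ) - 1) * (phi n s * sech n s * th n s + psi n s * sech n s ^ 2)) s :=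
  (((hasDerivAt_psi hn s).mul (hasDerivAt_th s)).sub (hasDerivAt_phi_mul_sech hn s)).congr_deriv
    (by ring)

theorem psi_zero : psi n 0 = 0 := by simp [psi]

theorem psi_nonneg {s : ℝ} (hs : 0 ≤ s) : 0 ≤ psi n s :=
  psi_zero (n := n) ▸ (psi_strictMono n).monotone hs

theorem phi_neg (s : ℝ) : phi n (-s) = phi n s := by simp [phi]

theorem sech_neg (s : ℝ) : sech n (-s) = sech n s := by simp [sech]

theorem th_neg (s : ℝ) : th n (-s) = -th n s := by simp [th]

theorem psi_neg (s : ℝ) : psi n (-s) = -psi n s := by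
  have h := intervalIntegral.integral_comp_neg (a := 0) (b := s)
    (fun t => phi n t ^ (2 - (n : ℝ)))
  simp only [phi_neg, neg_zero] at h
  rw [psi, psi, intervalIntegral.integral_symm, h]

theorem dilationField_neg (s : ℝ) : dilationField n (-s) = dilationField n s := by
  simp [dilationField, psi_neg, th_neg, phi_neg, sech_neg]

theorem th_nonneg (hn : 2 ≤ n) {s : ℝ} (hs : 0 ≤ s) : 0 ≤ th n s := by
  have hn2 : (2 : ℝ) ≤ n := by exact_mod_cast hn
  exact mul_nonneg (Real.sinh_nonneg_iff.2 (mul_nonneg (by linarith) hs))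
    (inv_nonneg.2 (Real.cosh_pos _).le)

theorem half_lt_th (hn : 2 ≤ n) {s : ℝ} (hs : 2 ≤ s) : 1 / 2 < th n s := by
  have hn2 : (2 : ℝ) ≤ n := by exact_mod_cast hn
  have hx : 2 ≤ ((n : ℝ) - 1) * s := by nlinarith
  have h1 : 2 ≤ Real.cosh (((n : ℝ) - 1) * s) :=
    (hx.trans (Real.self_le_sinh_iff.2 (by linarith))).trans (Real.sinh_lt_cosh _).le
  have h2 : sech n s ≤ 2⁻¹ := inv_anti₀ two_pos h1
  have h3 := th_sq (n := n) s
  have h4 := th_nonneg hn (by linarith : 0 ≤ s)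
  have h5 := sech_pos (n := n) s
  nlinarith

/-- `ψ' = φ sech` is nonincreasing on `[0, ∞)`, so `ψ(s) ≥ s ψ'(s)`. -/
theorem mul_phi_mul_sech_le_psi (hn : 2 ≤ n) {s : ℝ} (hs : 0 ≤ s) :
    s * (phi n s * sech n s) ≤ psi n s := by
  have hn2 : (2 : ℝ) ≤ n := by exact_mod_cast hn
  have hd : ∀ r, HasDerivAt (fun r => psi n r - r * (phi n r * sech n r))
      (((n : ℝ) - 2) * r * th n r * (phi n r * sech n r)) r := fun r =>
    ((hasDerivAt_psi hn r).sub ((hasDerivAt_id r).mul (hasDerivAt_phi_mul_sech hn r))).congr_deriv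
      (by simp; ring)
  have hm : MonotoneOn (fun r => psi n r - r * (phi n r * sech n r)) (Set.Ici 0) := by
    refine monotoneOn_of_deriv_nonneg (convex_Ici 0)
      (fun r _ => (hd r).continuousAt.continuousWithinAt)
      (fun r _ => (hd r).differentiableAt.differentiableWithinAt) fun r hr => ?_
    rw [interior_Ici, Set.mem_Ioi] at hr
    rw [(hd r).deriv]
    exact mul_nonneg (mul_nonneg (mul_nonneg (by linarith) hr.le) (th_nonneg hn hr.le))
      (mul_pos (phi_pos n r) (sech_pos r)).le
  have := hm (Set.mem_Ici.2 le_rfl) (Set.mem_Ici.2 hs) hs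
  simp only [psi_zero, zero_mul, sub_zero] at this
  linarith

/-- The field is monotone on `[0, ∞)`, and at `2` it is positive because `ψ ≥ 2 φ sech` and `th >
1/2`. -/
theorem exists_dilationField_ge (hn : 2 ≤ n) : ∃ κ > 0, ∀ s, 2 ≤ s → κ ≤ dilationField n s := by
  have hn2 : (2 : ℝ) ≤ n := by exact_mod_cast hn
  have hm : MonotoneOn (dilationField n) (Set.Ici 0) := by
    refine monotoneOn_of_deriv_nonneg (convex_Ici 0)
      (fun r _ => (hasDerivAt_dilationField hn r).continuousAt.continuousWithinAt)
      (fun r _ => (hasDerivAt_dilationField hn r).differentiableAt.differentiableWithinAt)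
      fun r hr => ?_
    rw [interior_Ici, Set.mem_Ioi] at hr
    rw [(hasDerivAt_dilationField hn r).deriv]
    have h1 := mul_nonneg (mul_pos (phi_pos n r) (sech_pos (n := n) r)).le (th_nonneg hn hr.le)
    have h2 := mul_nonneg (psi_nonneg (n := n) hr.le) (sq_nonneg (sech n r))
    exact mul_nonneg (by linarith) (add_nonneg h1 h2)
  refine ⟨dilationField n 2, ?_, fun s hs =>
    hm (Set.mem_Ici.2 zero_le_two) (Set.mem_Ici.2 (by linarith)) hs⟩
  have h1 := mul_phi_mul_sech_le_psi hn (s := 2) zero_le_two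
  have h2 := half_lt_th hn (s := 2) le_rfl
  have h3 := mul_pos (phi_pos n 2) (sech_pos (n := n) 2)
  rw [dilationField]
  nlinarith

/-- Variation of constants for rotationally symmetric Jacobi fields. -/
theorem eq_combination_of_ode (hn : 2 ≤ n) {g g' : ℝ → ℝ} (hg : ∀ s, HasDerivAt g (g' s) s)
    (hg' : ∀ s, HasDerivAt g'
      (-(((n : ℝ) - 2) * th n s * g' s) - n * ((n : ℝ) - 1) * sech n s ^ 2 * g s) s) :
    ∃ c₁ c₂ : ℝ, ∀ s, ((n : ℝ) - 1) * g s = c₂ * th n s - c₁ * dilationField n s := by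
  have hM : ∀ s, phi n s * sech n s ≠ 0 := fun s => (mul_pos (phi_pos n s) (sech_pos s)).ne'
  have hMd : ∀ s, HasDerivAt (fun s => (phi n s * sech n s)⁻¹)
      (((n : ℝ) - 2) * th n s * (phi n s * sech n s)⁻¹) s := fun s => by
    refine ((hasDerivAt_phi_mul_sech hn s).inv (hM s)).congr_deriv ?_
    have := hM s
    field_simp
    ring
  -- Abel's identity: the Wronskian of two solutions is proportional to `φ sech`.
  have hconst : ∀ w w' : ℝ → ℝ, (∀ s, HasDerivAt w (w' s) s) →
      (∀ s, HasDerivAt w'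
        (-(((n : ℝ) - 2) * th n s * w' s) - n * ((n : ℝ) - 1) * sech n s ^ 2 * w s) s) →
      ∃ c, ∀ s, (phi n s * sech n s)⁻¹ * (w' s * g s - w s * g' s) = c := by
    intro w w' hw hw'
    refine ⟨_, fun s => is_const_of_deriv_eq_zero (𝕜 := ℝ)
      (f := fun s => (phi n s * sech n s)⁻¹ * (w' s * g s - w s * g' s)) ?_ ?_ s 0⟩
    · exact fun s => ((hMd s).mul (((hw' s).mul (hg s)).sub
        ((hw s).mul (hg' s)))).differentiableAt
    · intro s
      refine (((hMd s).mul (((hw' s).mul (hg s)).sub ((hw s).mul (hg' s)))).congr_deriv ?_).deriv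
      simp only [Pi.sub_apply, Pi.mul_apply]
      ring
  -- `th` is the vertical component of the normal, the Jacobi field of vertical translation.
  obtain ⟨c₁, h1⟩ := hconst (th n) (fun s => ((n : ℝ) - 1) * sech n s ^ 2) hasDerivAt_th
    fun s => by
      refine (((hasDerivAt_sech s).pow 2).const_mul ((n : ℝ) - 1)).congr_deriv ?_
      simp
      ring
  obtain ⟨c₂, h2⟩ := hconst (dilationField n)
    (fun s => ((n : ℝ) - 1) * (phi n s * sech n s * th n s + psi n s * sech n s ^ 2))
    (hasDerivAt_dilationField hn) fun s => by
      refine ((((hasDerivAt_phi_mul_sech hn s).mul (hasDerivAt_th s)).add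
        ((hasDerivAt_psi hn s).mul ((hasDerivAt_sech s).pow 2))).const_mul
          ((n : ℝ) - 1)).congr_deriv ?_
      simp [dilationField]
      ring
  refine ⟨c₁, c₂, fun s => ?_⟩
  have hT := th_sq (n := n) s
  -- Eliminating `g'` from the two Wronskians leaves `g` times the Wronskian of `th` and
  -- `dilationField`, which is `(n-1) φ sech` up to sign.
  rw [← h1 s, ← h2 s, dilationField]
  have := hM s
  have hq := (sech_pos (n := n) s).ne'
  have hφ := (phi_pos n s).ne'
  field_simp
  linear_combination (-(phi n s * sech n s * ((n : ℝ) - 1) * g s)) * hT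

theorem eq_zero_of_forall_abs_mul_lt {c κ : ℝ} (hκ : 0 < κ) {h : ℝ → ℝ}
    (hh : ∀ s, 2 ≤ s → κ ≤ h s) (hc : ∀ ε > 0, ∃ s, 2 ≤ s ∧ |c * h s| < ε) : c = 0 := by
  by_contra hne
  obtain ⟨s, hs, hlt⟩ := hc (|c| * κ) (mul_pos (abs_pos.2 hne) hκ)
  rw [abs_mul] at hlt
  have := mul_le_mul_of_nonneg_left ((hh s hs).trans (le_abs_self _)) (abs_nonneg c)
  linarith

/-- A rotationally symmetric Jacobi field that vanishes at both ends is zero. -/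
theorem eq_zero_of_ode (hn : 2 ≤ n) {g g' : ℝ → ℝ} (hg : ∀ s, HasDerivAt g (g' s) s)
    (hg' : ∀ s, HasDerivAt g'
      (-(((n : ℝ) - 2) * th n s * g' s) - n * ((n : ℝ) - 1) * sech n s ^ 2 * g s) s)
    (hlim : ∀ ε > 0, ∃ R : ℝ, ∀ s, R ≤ |s| → |g s| < ε) (s : ℝ) : g s = 0 := by
  have hn2 : (2 : ℝ) ≤ n := by exact_mod_cast hn
  have hn0 : 0 < (n : ℝ) - 1 := by linarith
  obtain ⟨c₁, c₂, h⟩ := eq_combination_of_ode hn hg hg'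
  have hfar : ∀ ε > 0, ∃ s, 2 ≤ s ∧ |((n : ℝ) - 1) * g s| < ε ∧ |((n : ℝ) - 1) * g (-s)| < ε := by
    intro ε hε
    obtain ⟨R, hR⟩ := hlim (ε / ((n : ℝ) - 1)) (div_pos hε hn0)
    refine ⟨max 2 R, le_max_left _ _, ?_, ?_⟩
    · rw [abs_mul, abs_of_pos hn0, ← lt_div_iff₀' hn0]
      exact hR _ ((le_max_right _ _).trans (le_abs_self _))
    · rw [abs_mul, abs_of_pos hn0, ← lt_div_iff₀' hn0]
      exact hR _ (by rw [abs_neg]; exact (le_max_right _ _).trans (le_abs_self _))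
  -- Adding and subtracting the values at `s` and `-s` separates the even dilation part from the odd
  -- translation part.
  have hodd : ∀ ε > 0, ∃ s, 2 ≤ s ∧ |c₁ * dilationField n s| < ε ∧ |c₂ * th n s| < ε := by
    intro ε hε
    obtain ⟨s, hs, h1, h2⟩ := hfar ε hε
    refine ⟨s, hs, ?_, ?_⟩
    · rw [h] at h1 h2
      rw [dilationField_neg, th_neg] at h2
      rw [abs_lt] at *
      constructor <;> linarith
    · rw [h] at h1 h2
      rw [dilationField_neg, th_neg] at h2
      rw [abs_lt] at *
      constructor <;> linarith
  obtain ⟨κ, hκ, hdil⟩ := exists_dilationField_ge hn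
  have e1 : c₁ = 0 := eq_zero_of_forall_abs_mul_lt hκ hdil fun ε hε => by
    obtain ⟨s, hs, h1, -⟩ := hodd ε hε
    exact ⟨s, hs, h1⟩
  have e2 : c₂ = 0 := eq_zero_of_forall_abs_mul_lt (h := th n) (one_half_pos)
    (fun s hs => (half_lt_th hn hs).le) fun ε hε => by
      obtain ⟨s, hs, -, h2⟩ := hodd ε hε
      exact ⟨s, hs, h2⟩
  have := h s
  rw [e1, e2] at this
  simpa [hn0.ne'] using this

theorem IsVanishingSolution.eq_zero_of_even (hn : 2 ≤ n) {u : ℝ → EuclideanSpace ℝ (Fin n) → ℝ}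
    (hu : IsVanishingSolution n u) (heven : ∀ s x, ‖x‖ = 1 → u s (-x) = u s x) (s : ℝ)
    {x : EuclideanSpace ℝ (Fin n)} (hx : ‖x‖ = 1) : u s x = 0 := by
  have hrad : ∀ s y, ‖y‖ = 1 → u s y = u s x := fun s y hy =>
    le_antisymm (hu.le_of_even hn heven s hy hx) (hu.le_of_even hn heven s hx hy)
  obtain ⟨e, rfl⟩ := exists_orthonormalBasis hn hx
  have key : ∀ s, ∃ u₁, HasTwoJetAt (fun r => u r (e none)) u₁
      (-(((n : ℝ) - 2) * th n s * u₁) - n * ((n : ℝ) - 1) * sech n s ^ 2 * u s (e none)) s := by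
    intro s
    obtain ⟨u₁, u₂, d₁, d₂, h1, h2, h3⟩ := hu.solves s e
    -- By symmetry `u` is constant along great circles, so the spherical Laplacian drops out.
    have hd : ∀ i, d₂ i = 0 := fun i => by
      refine ((h2 i).unique (h₁ := 0) ?_).2
      have : (fun r => u s (Real.cos r • e none + Real.sin r • e (some i))) =
          fun _ => u s (e none) := funext fun r =>
        hrad s _ (norm_arc hx (e.orthonormal.1 (some i)) (e.orthonormal.2 (by simp)) r)
      rw [this]
      exact HasTwoJetAt.of_hasDerivAt (fun r => hasDerivAt_const r _) (hasDerivAt_const 0 _)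
    refine ⟨u₁, ?_⟩
    convert h1 using 1
    simp only [hd, Finset.sum_const_zero] at h3
    linarith
  have hg : ∀ s, HasDerivAt (fun r => u r (e none)) (deriv (fun r => u r (e none)) s) s := by
    intro s
    obtain ⟨u₁, g', -, h1, -⟩ := key s
    exact h1.self_of_nhds.differentiableAt.hasDerivAt
  refine eq_zero_of_ode hn hg (fun s => ?_) (fun ε hε => ?_) s
  · obtain ⟨u₁, g', rfl, h1, h2⟩ := key s
    have hd : deriv (fun r => u r (e none)) =ᶠ[𝓝 s] g' := h1.mono fun r hr => hr.deriv
    rw [hd.self_of_nhds]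
    exact h2.congr_of_eventuallyEq hd
  · obtain ⟨R, hR⟩ := hu.vanishes ε hε
    exact ⟨R, fun s hs => hR s _ hx hs⟩

/-! ### Continuity and decay inherited from the Jacobi field -/

theorem continuous_psi (hn : 2 ≤ n) : Continuous (psi n) :=
  continuous_iff_continuousAt.2 fun s => (hasDerivAt_psi hn s).continuousAt

theorem continuous_lift (hn : 2 ≤ n) :
    Continuous fun q : ℝ × EuclideanSpace ℝ (Fin n) => lift n q.1 q.2 := by
  have h1 := continuous_phi n
  have h2 := continuous_psi hn
  exact (WithLp.prod_continuous_toLp 2 _ _).comp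
    (((h1.comp continuous_fst).smul continuous_snd).prodMk (h2.comp continuous_fst))

/-- `cosh s ≥ |s|`, and negative powers tend to zero at infinity. -/
theorem exists_forall_mul_cosh_rpow_lt (C : ℝ) {δ : ℝ} (hδ : δ < 0) {ε : ℝ} (hε : 0 < ε) :
    ∃ R : ℝ, ∀ s, R ≤ |s| → C * Real.cosh s ^ δ < ε := by
  have h1 : Tendsto (fun y : ℝ => C * y ^ δ) atTop (𝓝 (C * 0)) := by
    have := tendsto_rpow_neg_atTop (neg_pos.2 hδ)
    rw [neg_neg] at this
    exact this.const_mul C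
  rw [mul_zero] at h1
  obtain ⟨R, hR⟩ := eventually_atTop.1 (h1.eventually (gt_mem_nhds hε))
  refine ⟨R, fun s hs => hR _ (hs.trans ?_)⟩
  rw [← Real.cosh_abs]
  exact (Real.self_le_sinh_iff.2 (abs_nonneg s)).trans (Real.sinh_lt_cosh _).le

end Catenoid

end

theorem proposition4 (n : ℕ) (hn : 2 ≤ n) (δ : ℝ) (hδ : δ < 0)
    (f : Catenoid.Ambient n → ℝ)
    (hf : Hypersurface.IsJacobiField (Catenoid.surface n) (Catenoid.normal n) f)
    (hbound : ∃ C : ℝ, ∀ (s : ℝ) (Θ : Catenoid.UnitSphere n),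
      |f (Catenoid.param n (s, Θ))| ≤ C * Real.cosh s ^ δ)
    (hsymm : ∀ (s : ℝ) (Θ : Catenoid.UnitSphere n),
      f (Catenoid.param n (s, -Θ)) = f (Catenoid.param n (s, Θ))) :
    ∀ p ∈ Catenoid.surface n, f p = 0 := by
  obtain ⟨C, hC⟩ := hbound
  have hu : Catenoid.IsVanishingSolution n fun s x => f (Catenoid.lift n s x) :=
    { solves := Catenoid.solvesJacobiEquation_of_isJacobiField hn hf
      continuousOn := hf.1.continuousOn.comp (Catenoid.continuous_lift hn).continuousOn
        fun q hq => Catenoid.lift_mem_surface q.1 (by simpa using hq.2)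
      vanishes := fun ε hε => by
        obtain ⟨R, hR⟩ := Catenoid.exists_forall_mul_cosh_rpow_lt C hδ hε
        exact ⟨R, fun s x hx hs => (hC s ⟨x, by simpa using hx⟩).trans_lt (hR s hs)⟩ }
  rintro _ ⟨⟨s, Θ⟩, rfl⟩
  exact hu.eq_zero_of_even hn (fun s x hx => hsymm s ⟨x, by simpa using hx⟩) s
    (by simp : ‖(Θ : EuclideanSpace ℝ (Fin n))‖ = 1)
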